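/- Let $K$ be a number field and $m\ge 0$. Let $N(\mathfrak p)$ denote the absolute norm of a (nonzero) prime $\mathfrak p$ of $K$. For every prime $\mathfrak p$ let $b_{\mathfrak p},c_{\mathfrak p,1},\dots,c_{\mathfrak p,m}$ be complex numbers such that $b_{\mathfrak p}=1$ for all but finitely many $\mathfrak p$ and the numbers $c_{\mathfrak p,i}$ are bounded. Let $$D_{\mathfrak p}(s_1,\dots,s_m)=b_{\mathfrak p}+c_{\mathfrak p,1}N(\mathfrak p)^{-s_1}+\cdots+c_{\mathfrak p,m}N(\mathfrak p)^{-s_m},\qquad D_{\mathfrak p,i}(s)=1+c_{\mathfrak p,i}N(\mathfrak p)^{-s},$$ and formally expand $$\prod_{\mathfrak p}D_{\mathfrak p}(s_1,\dots,s_m)=\sum_{x_1,\dots,x_m\ge 1}a_{x_1,\dots,x_m}x_1^{-s_1}\cdots x_m^{-s_m}.$$ Let the real number $E_0$ be large enough so that for all $\mathfrak p$ with $N(\mathfrak p)>E_0$ we have $b_{\mathfrak p}=1$ and, for every $i$, $D_{\mathfrak p,i}(s)\ne 0$ for all $s$ with $\operatorname{Re}(s)=1$. For each $i$, assume that the function $$(s-1)\prod_{\mathfrak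 p:\,N(\mathfrak p)>E_0}D_{\mathfrak p,i}(s)\qquad(\operatorname{Re}(s)>1)$$ can be holomorphically continued to (a neighbourhood of) $\{\operatorname{Re}(s)\ge 1\}$, with value $r_i$ at $s=1$. Furthermore, assume that there are bounded real numbers $c'_{\mathfrak p,i}\ge|c_{\mathfrak p,i}|$ such that, putting $D'_{\mathfrak p,i}(s)=1+c'_{\mathfrak p,i}N(\mathfrak p)^{-s}$, for each $i$ the function $$(s-1)\prod_{\mathfrak p:\,N(\mathfrak p)>E_0}D'_{\mathfrak p,i}(s)$$ can be holomorphically continued to (a neighbourhood of) $\{\operatorname{Re}(s)\ge 1\}$. Then, as $X_1,\dots,X_m$ all go to $\infty$, $$\sum_{x_1\le X_1,\dots,x_m\le X_m}a_{x_1,\dots,x_m}=C\,X_1\cdots X_m+o(X_1\cdots X_m)$$ with $$C=r_1\cdots r_m\cdot\prod_{\mathfrak p:\,N(\mathfrak p)\le E_0}D_{\mathfrak p}(1,\dots,1)\prod_{\mathfrak p:\,N(\mathfrak p)>E_0}\frac{D_{\mathfrak p}(1,\dots,1)}{D_{\mathfrak p,1}(1)\cdots D_{\mathfrak p,m}(1)},$$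 where the last product converges unconditionally. -/

import Mathlib

open Filter Asymptotics
open scoped NumberField

namespace MultiTauberian

noncomputable section

/-- The (finite) primes of a number field `K`: the nonzero prime ideals of its ring of integers. -/
abbrev Pr (K : Type*) [Field K] [NumberField K] : Type _ :=
  IsDedekindDomain.HeightOneSpectrum (𝓞 K)

variable {K : Type*} [Field K] [NumberField K] {m : ℕ}

/-- The absolute norm of a prime of `K`, that is, the size of its residue field. -/
def Nm (p : Pr K) : ℕ := Ideal.absNorm p.asIdeal

/-- The local factor `b_p + ∑ i, c_{p,i} N(p)^{-s_i}` in several complex variables. -/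
def localFactor (b : Pr K → ℂ) (c : Pr K → Fin m → ℂ) (p : Pr K) (s : Fin m → ℂ) : ℂ :=
  b p + ∑ i, c p i * (Nm p : ℂ) ^ (-s i)

/-- The one-variable local factor `1 + γ_p N(p)^{-s}`. -/
def localFactorOne (γ : Pr K → ℂ) (p : Pr K) (s : ℂ) : ℂ :=
  1 + γ p * (Nm p : ℂ) ^ (-s)

/-- The one-variable Euler product of the factors `1 + γ_p N(p)^{-s}` over the primes `p` with
`N(p) > E`. For bounded `γ` it converges absolutely on `Re s > 1`. -/
def tailProduct (E : ℝ) (γ : Pr K → ℂ) (s : ℂ) : ℂ :=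
  ∏' p : {p : Pr K // E < (Nm p : ℝ)}, localFactorOne γ p.1 s

/-- `f`, a function on `Re s > 1`, can be continued holomorphically to the closed half plane
`Re s ≥ 1` (i.e. to a neighbourhood of each of its points), with value `r` at `s = 1`. -/
def ContinuesWithValue (f : ℂ → ℂ) (r : ℂ) : Prop :=
  ∃ g : ℂ → ℂ, AnalyticOnNhd ℂ g {s : ℂ | 1 ≤ s.re} ∧
    (∀ s : ℂ, 1 < s.re → g s = f s) ∧ g 1 = r

/-- A term of the formally expanded product is given by selecting one summand from each local
factor: `0` selects `b_p` and `i.succ` selects `c_{p,i} N(p)^{-s_i}`, where the latter is done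
for finitely many `p` only. This is the number `x_i` for which `x_i^{-s_i}` occurs in the term
selected by `σ`, i.e. the product of `N(p)` over the primes `p` at which `i` is selected. -/
def selNorm (σ : Pr K →₀ Fin (m + 1)) (i : Fin m) : ℕ :=
  ∏ p ∈ σ.support with σ p = i.succ, Nm p

/-- The coefficient of the term selected by `σ`: the product of the selected `b_p` or `c_{p,i}`
over all primes `p`. (Almost all factors are `1` if almost all `b_p` are `1`.) -/
def selCoeff (b : Pr K → ℂ) (c : Pr K → Fin m → ℂ) (σ : Pr K →₀ Fin (m + 1)) : ℂ :=
  ∏ᶠ p : Pr K, (Fin.cons (b p) (c p) : Fin (m + 1) → ℂ) (σ p)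

/-- The coefficient `a_x` of `x_1^{-s_1} ⋯ x_m^{-s_m}` in the formal expansion of the product of
all the local factors: the sum of the coefficients of the terms in which this monomial occurs
(finitely many, see `finite_selNorm_eq`). -/
def coeff (b : Pr K → ℂ) (c : Pr K → Fin m → ℂ) (x : Fin m → ℕ) : ℂ :=
  ∑ᶠ σ ∈ {σ : Pr K →₀ Fin (m + 1) | ∀ i, selNorm σ i = x i}, selCoeff b c σ

/-- The sum of the coefficients `a_x` over all `x` with `1 ≤ x_i ≤ X_i` for all `i`. -/
def coeffSum (b : Pr K → ℂ) (c : Pr K → Fin m → ℂ) (X : Fin m → ℝ) : ℂ :=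
  ∑ x ∈ Fintype.piFinset (fun i => Finset.Icc 1 ⌊X i⌋₊), coeff b c x

/-- The quotient `D_p(1, …, 1) / (D_{p,1}(1) ⋯ D_{p,m}(1))`. -/
def localQuotient (b : Pr K → ℂ) (c : Pr K → Fin m → ℂ) (p : Pr K) : ℂ :=
  localFactor b c p (fun _ => 1) / ∏ i, localFactorOne (fun q => c q i) p 1

/-- The constant `C` of the asymptotic formula. -/
def mainConst (b : Pr K → ℂ) (c : Pr K → Fin m → ℂ) (E : ℝ) (r : Fin m → ℂ) : ℂ :=
  (∏ i, r i) *
    (∏ᶠ p ∈ {p : Pr K | (Nm p : ℝ) ≤ E}, localFactor b c p (fun _ => 1)) *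
    ∏' p : {p : Pr K // E < (Nm p : ℝ)}, localQuotient b c p.1

/-- There are only finitely many primes of bounded norm. -/
theorem finite_Nm_le (E : ℝ) : {p : Pr K | (Nm p : ℝ) ≤ E}.Finite := by
  have h : {I : Ideal (𝓞 K) | Ideal.absNorm I ≤ ⌊E⌋₊}.Finite := Ideal.finite_setOfPred_absNorm_le _
  refine Set.Finite.subset (h.preimage (f := fun p : Pr K => p.asIdeal) ?_) ?_
  · intro p _ q _ hpq
    exact IsDedekindDomain.HeightOneSpectrum.ext hpq
  · intro p hp
    exact Nat.le_floor hp

theorem Nm_pos (p : Pr K) : 0 < Nm p := by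
  refine Nat.pos_of_ne_zero fun h => p.ne_bot ?_
  exact Ideal.absNorm_eq_zero_iff.mp h

/-- Each monomial occurs in only finitely many terms of the formal expansion. -/
theorem finite_selNorm_eq (x : Fin m → ℕ) :
    {σ : Pr K →₀ Fin (m + 1) | ∀ i, selNorm σ i = x i}.Finite := by
  classical
  let T : Finset (Pr K) := (finite_Nm_le (K := K) ((∑ i, x i : ℕ) : ℝ)).toFinset
  refine Set.Finite.subset (Finset.finite_toSet (T.finsupp fun _ => Finset.univ)) ?_
  intro σ hσ
  have hsub : σ.support ⊆ T := by
    intro p hp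
    obtain ⟨i, hi⟩ := Fin.exists_succ_eq.mpr (Finsupp.mem_support_iff.mp hp)
    have hdvd : Nm p ∣ x i := by
      rw [← hσ i]
      exact Finset.dvd_prod_of_mem _ (by simp [hi.symm])
    have hpos : 0 < x i := by
      rw [← hσ i]
      exact Finset.prod_pos fun q _ => Nm_pos q
    have hle : Nm p ≤ ∑ i, x i :=
      (Nat.le_of_dvd hpos hdvd).trans (Finset.single_le_sum (f := x) (by simp) (Finset.mem_univ i))
    simpa [T] using (by exact_mod_cast hle : (Nm p : ℝ) ≤ ((∑ i, x i : ℕ) : ℝ))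
  exact Finset.mem_coe.mpr (by
    rw [Finset.mem_finsupp_iff]
    exact ⟨hsub, fun _ _ => Finset.mem_univ _⟩)

end

end MultiTauberian

/-! The one-variable input is a Wiener–Ikehara theorem (`wienerIkehara`) for complex coefficients
dominated by those of a nonnegative series; here the majorant comes from `c'`. It is proved with
Fejér averages: Parseval turns an average into an integral of the Laplace transform over a compact
vertical segment, Riemann–Lebesgue makes it tend to zero, and monotonicity removes the averaging.
Hence, for each `i`, the coefficient sums of `∏ (1 + c_{p,i} N(p)^{-s})` over `N(p) > E₁`, divided
by `x`, are bounded and converge (`tendsto_sumLe_cutoff`).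

To pass to several variables, the monomial `∏ y_i^{-s_i}` acts on bounded functions of `X` by `Φ ↦
(∏ y)⁻¹ Φ(X / y)`, with norm at most `(∏ y)⁻¹`. The closed algebra generated by these shifts is a
commutative Banach algebra, each of whose elements multiplies limits at infinity by a character
`chi`, which is evaluation at `s = (1, …, 1)`. For large `N(p)`, each `1 + c_{p,i} N(p)^{-s_i}` is
invertible in it, so `D_p = h_p ∏_i D_{p,i}`. Since numerator and denominator agree to first order,
`h_p = 1 + O(N(p)⁻²)` (`exists_quotient`), and `H = ∏ h_p` converges absolutely.

The product `Ψ` of the `m` normalized one-variable sums is bounded and tends to the product of their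
limits. Applying `H` to `Ψ` gives exactly the normalized multivariable coefficient sum
(`act_eq_coeffSum_div`), which therefore tends to `chi H` times that product. Finally the auxiliary
threshold `E₁` cancels from the constant. -/

namespace MultiTauberian
noncomputable section
-- The Fejér kernel.
open MeasureTheory Set Topology

/-- The Fejér kernel, as the Fourier transform of the triangle function. -/
def fejer (t : ℝ) : ℝ := ∫ ξ in (-1 : ℝ)..1, (1 - |ξ|) * Real.cos (ξ * t)

/-- Two integrations by parts. The factor `t ^ 2` stays on the left so that `t = 0` is no exception;
nonnegativity and quadratic decay both follow. -/
theorem fejer_mul_sq (t : ℝ) : fejer t * t ^ 2 = 2 * (1 - Real.cos t) := by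
  have hint : ∀ a b : ℝ, IntervalIntegrable (fun ξ : ℝ => (1 - |ξ|) * Real.cos (ξ * t))
      volume a b := fun a b => Continuous.intervalIntegrable (by fun_prop) a b
  have hneg : ∫ ξ in (-1 : ℝ)..0, (1 - |ξ|) * Real.cos (ξ * t) =
      ∫ ξ in (0 : ℝ)..1, (1 - |ξ|) * Real.cos (ξ * t) := by
    have := intervalIntegral.integral_comp_neg (a := (-1 : ℝ)) (b := 0)
      (fun ξ : ℝ => (1 - |ξ|) * Real.cos (ξ * t))
    simpa using this
  have hpos : t ^ 2 * ∫ ξ in (0 : ℝ)..1, (1 - |ξ|) * Real.cos (ξ * t) = 1 - Real.cos t := by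
    rw [← intervalIntegral.integral_const_mul]
    have hd : ∀ ξ : ℝ, HasDerivAt (fun ξ => (1 - ξ) * (t * Real.sin (ξ * t)) - Real.cos (ξ * t))
        (t ^ 2 * ((1 - ξ) * Real.cos (ξ * t))) ξ := by
      intro ξ
      have h1 : HasDerivAt (fun ξ : ℝ => ξ * t) t ξ := by simpa using (hasDerivAt_id ξ).mul_const t
      have h2 := h1.sin.const_mul t
      have h3 : HasDerivAt (fun ξ : ℝ => 1 - ξ) (-1) ξ := by
        simpa using (hasDerivAt_id ξ).const_sub 1
      have := (h3.mul h2).sub h1.cos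
      convert! this using 1
      ring
    have := intervalIntegral.integral_eq_sub_of_hasDerivAt (a := 0) (b := 1) (fun ξ _ => hd ξ)
      (Continuous.intervalIntegrable (by fun_prop) _ _)
    rw [intervalIntegral.integral_congr (g := fun ξ => t ^ 2 * ((1 - ξ) * Real.cos (ξ * t)))]
    · rw [this]; simp; ring
    · intro ξ hξ
      rw [uIcc_of_le zero_le_one] at hξ
      simp only [abs_of_nonneg hξ.1]
  rw [fejer, ← intervalIntegral.integral_add_adjacent_intervals (hint (-1) 0) (hint 0 1), hneg,
    mul_comm, mul_add, hpos]
  ring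

theorem abs_fejer_le (t : ℝ) : |fejer t| ≤ 2 := by
  have := intervalIntegral.norm_integral_le_of_norm_le_const (a := -1) (b := 1) (C := 1)
    (f := fun ξ : ℝ => (1 - |ξ|) * Real.cos (ξ * t)) (fun ξ hξ => by
      rw [uIoc_of_le (by norm_num)] at hξ
      have h1 : |ξ| ≤ 1 := abs_le.2 ⟨hξ.1.le, hξ.2⟩
      rw [norm_mul, Real.norm_eq_abs, Real.norm_eq_abs, abs_of_nonneg (by linarith)]
      exact mul_le_one₀ (by linarith [abs_nonneg ξ]) (abs_nonneg _) (Real.abs_cos_le_one _))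
  rw [fejer]
  norm_num at this ⊢
  exact this

theorem fejer_zero : fejer 0 = 1 := by
  have : fejer 0 = ∫ ξ in (-1 : ℝ)..1, (1 - |ξ|) := by simp [fejer]
  have h0 : ∫ ξ in (-1 : ℝ)..0, |ξ| = ∫ ξ in (0 : ℝ)..1, |ξ| := by
    simpa using intervalIntegral.integral_comp_neg (a := (-1 : ℝ)) (b := 0) (fun ξ : ℝ => |ξ|)
  have h1 : ∫ ξ in (0 : ℝ)..1, |ξ| = 1 / 2 := by
    rw [intervalIntegral.integral_congr (g := fun ξ => ξ)]
    · norm_num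
    · intro ξ hξ
      rw [uIcc_of_le zero_le_one] at hξ
      exact abs_of_nonneg hξ.1
  rw [this, intervalIntegral.integral_sub (by simp) (Continuous.intervalIntegrable (by fun_prop) _ _),
    ← intervalIntegral.integral_add_adjacent_intervals (f := fun ξ : ℝ => |ξ|) (b := 0)
    (Continuous.intervalIntegrable (by fun_prop) _ _)
    (Continuous.intervalIntegrable (by fun_prop) _ _), h0, h1]
  norm_num

theorem fejer_nonneg (t : ℝ) : 0 ≤ fejer t := by
  rcases eq_or_ne t 0 with rfl | ht
  · simp [fejer_zero]
  · have h : 0 < t ^ 2 := by positivity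
    refine nonneg_of_mul_nonneg_left ?_ h
    rw [fejer_mul_sq]
    linarith [Real.cos_le_one t]

theorem continuous_fejer : Continuous fejer := by
  unfold fejer
  exact intervalIntegral.continuous_parametric_intervalIntegral_of_continuous' (by fun_prop) _ _

theorem integrable_fejer : Integrable fejer := by
  -- `6 = 2 + 4`: the kernel is at most `2`, and `t ^ 2` times it is `2 (1 - cos t) ≤ 4`.
  refine (integrable_inv_one_add_sq.const_mul 6).mono' continuous_fejer.aestronglyMeasurable
    (Eventually.of_forall fun t => ?_)
  have h : 0 < 1 + t ^ 2 := by positivity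
  rw [Real.norm_eq_abs, ← div_eq_mul_inv, le_div_iff₀ h, abs_of_nonneg (fejer_nonneg t), mul_add,
    fejer_mul_sq]
  linarith [abs_le.1 (abs_fejer_le t), Real.neg_one_le_cos t]

theorem integral_fejer_pos : 0 < ∫ t, fejer t :=
  integral_pos_of_integrable_nonneg_nonzero continuous_fejer integrable_fejer fejer_nonneg
    (x := 0) (by simp [fejer_zero])

/-- The sine part is odd and integrates to zero. The compact support of the triangle is what later
confines the Laplace transform to a bounded segment. -/
theorem ofReal_fejer (t : ℝ) :
    (fejer t : ℂ) = ∫ ξ in (-1 : ℝ)..1, ((1 - |ξ| : ℝ) : ℂ) * Complex.exp ((ξ * t : ℝ) * Complex.I) := by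
  have hodd : ∫ ξ in (-1 : ℝ)..1, (1 - |ξ|) * Real.sin (ξ * t) = 0 := by
    have := intervalIntegral.integral_comp_neg (a := (-1 : ℝ)) (b := 1)
      (fun ξ : ℝ => (1 - |ξ|) * Real.sin (ξ * t))
    simp only [abs_neg, neg_mul, Real.sin_neg, mul_neg, intervalIntegral.integral_neg, neg_neg]
      at this
    linarith
  have : ∀ ξ : ℝ, ((1 - |ξ| : ℝ) : ℂ) * Complex.exp ((ξ * t : ℝ) * Complex.I) =
      (((1 - |ξ|) * Real.cos (ξ * t) : ℝ) : ℂ) +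
        (((1 - |ξ|) * Real.sin (ξ * t) : ℝ) : ℂ) * Complex.I := by
    intro ξ
    rw [Complex.exp_mul_I]
    push_cast
    ring
  simp_rw [this]
  rw [intervalIntegral.integral_add (Continuous.intervalIntegrable (by fun_prop) _ _)
    (Continuous.intervalIntegrable (by fun_prop) _ _), intervalIntegral.integral_mul_const,
    intervalIntegral.integral_ofReal, intervalIntegral.integral_ofReal, hodd, fejer]
  simp

end
end MultiTauberian

/-! ### Fejér averages and boundary values of Laplace transforms. -/

namespace MultiTauberian
noncomputable section
open MeasureTheory Set Topology

/-- Parseval's identity against a translated and rescaled Fejér kernel. -/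
theorem integral_mul_fejer {μ : Measure ℝ} [SFinite μ] {w : ℝ → ℂ} (hw : Integrable w μ) (T z : ℝ) :
    ∫ t, w t * (fejer (T * (t - z)) : ℂ) ∂μ =
      ∫ ξ in (-1 : ℝ)..1, ((1 - |ξ| : ℝ) : ℂ) * Complex.exp ((-(ξ * T * z) : ℝ) * Complex.I) *
        ∫ t, w t * Complex.exp ((ξ * T * t : ℝ) * Complex.I) ∂μ := by
  simp_rw [ofReal_fejer, intervalIntegral.integral_of_le (show (-1 : ℝ) ≤ 1 by norm_num),
    ← integral_const_mul]
  rw [integral_integral_swap]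
  · refine integral_congr_ae (Eventually.of_forall fun ξ => integral_congr_ae
      (Eventually.of_forall fun t => ?_))
    have hexp : Complex.exp ((ξ * (T * (t - z)) : ℝ) * Complex.I) =
        Complex.exp ((-(ξ * T * z) : ℝ) * Complex.I) *
          Complex.exp ((ξ * T * t : ℝ) * Complex.I) := by
      rw [← Complex.exp_add]
      congr 1
      push_cast
      ring
    simp only [hexp]
    ring
  · have h1 : Integrable (fun ξ : ℝ => ((1 - |ξ| : ℝ) : ℂ)) (volume.restrict (Ioc (-1) 1)) :=
      (Continuous.integrableOn_Ioc (by fun_prop))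
    have h2 := (hw.mul_prod h1).mul_bdd (c := 1)
      (g := fun p : ℝ × ℝ => Complex.exp ((p.2 * (T * (p.1 - z)) : ℝ) * Complex.I))
      (Continuous.aestronglyMeasurable (by fun_prop))
      (Eventually.of_forall fun p => (Complex.norm_exp_ofReal_mul_I _).le)
    refine h2.congr (Eventually.of_forall fun p => ?_)
    simp only [Function.uncurry]
    ring

theorem integral_fejer_comp {T : ℝ} (hT : 0 < T) (z : ℝ) :
    ∫ t, fejer (T * (t - z)) = T⁻¹ * ∫ t, fejer t := by
  rw [integral_sub_right_eq_self (fun t => fejer (T * t)) z, Measure.integral_comp_mul_left,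
    abs_of_pos (inv_pos.2 hT), smul_eq_mul]

theorem integrable_fejer_comp {T : ℝ} (hT : 0 < T) (z : ℝ) :
    Integrable fun t => fejer (T * (t - z)) :=
  (integrable_fejer.comp_mul_left' hT.ne').comp_sub_right z

/-- The Laplace transform of `v`, as a function on the open right half plane, has a continuous
extension to the closed right half plane, near its boundary. -/
def LaplaceContinues (v : ℝ → ℂ) : Prop :=
  ∀ T : ℝ, 0 < T → ∃ η : ℝ, 0 < η ∧ ∃ g : ℂ → ℂ, ContinuousOn g (Icc 0 η ×ℂ Icc (-T) T) ∧
    ∀ w ∈ Icc 0 η ×ℂ Icc (-T) T, 0 < w.re → ∫ t in Ioi (0 : ℝ), v t * Complex.exp (-w * t) = g w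

theorem mem_reProdIm_of_mem_Icc {η T ε ξ : ℝ} (hT : 0 < T) (hε : ε ∈ Icc 0 η)
    (hξ : ξ ∈ Icc (-1 : ℝ) 1) :
    (ε - (ξ * T : ℝ) * Complex.I : ℂ) ∈ Icc 0 η ×ℂ Icc (-T) T := by
  rw [Complex.mem_reProdIm]
  simp only [Complex.sub_re, Complex.ofReal_re, Complex.mul_re, Complex.I_re, mul_zero,
    Complex.ofReal_im, Complex.I_im, sub_self, sub_zero, Complex.sub_im,
    Complex.mul_im, mul_one, add_zero, zero_sub]
  refine ⟨hε, ?_, ?_⟩ <;> nlinarith [hξ.1, hξ.2]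

/-- The damping `exp (-ε t)` gives absolute convergence, and the inner integral in Parseval's
identity becomes the Laplace transform at `ε - iξT`. -/
theorem LaplaceContinues.exists_parseval {v : ℝ → ℂ} (h : LaplaceContinues v)
    (hv : ∀ ε : ℝ, 0 < ε → IntegrableOn (fun t => v t * (Real.exp (-ε * t) : ℂ)) (Ioi 0))
    {T : ℝ} (hT : 0 < T) :
    ∃ η : ℝ, 0 < η ∧ ∃ g : ℂ → ℂ, ContinuousOn g (Icc 0 η ×ℂ Icc (-T) T) ∧
      ∀ ε ∈ Ioc 0 η, ∀ z : ℝ,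
        ∫ t in Ioi (0 : ℝ), v t * (Real.exp (-ε * t) : ℂ) * (fejer (T * (t - z)) : ℂ) =
        ∫ ξ in (-1 : ℝ)..1, ((1 - |ξ| : ℝ) : ℂ) * Complex.exp ((-(ξ * T * z) : ℝ) * Complex.I) *
          g (ε - (ξ * T : ℝ) * Complex.I) := by
  obtain ⟨η, hη, g, hg, hgL⟩ := h T hT
  refine ⟨η, hη, g, hg, fun ε hε z => ?_⟩
  rw [integral_mul_fejer (hv ε hε.1)]
  refine intervalIntegral.integral_congr fun ξ hξ => ?_
  rw [uIcc_of_le (by norm_num)] at hξ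
  rw [← hgL _ (mem_reProdIm_of_mem_Icc hT ⟨hε.1.le, hε.2⟩ hξ) (by simpa using hε.1)]
  congr 1
  refine integral_congr_ae (Eventually.of_forall fun t => ?_)
  simp only
  rw [mul_assoc, Complex.ofReal_exp, ← Complex.exp_add]
  congr 2
  push_cast
  ring

theorem continuousOn_comp_vertical {η T ε : ℝ} (hT : 0 < T) (hε : ε ∈ Icc 0 η) {g : ℂ → ℂ}
    (hg : ContinuousOn g (Icc 0 η ×ℂ Icc (-T) T)) :
    ContinuousOn (fun ξ : ℝ => g (ε - (ξ * T : ℝ) * Complex.I)) (Icc (-1) 1) :=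
  hg.comp (Continuous.continuousOn (by fun_prop)) fun _ hξ => mem_reProdIm_of_mem_Icc hT hε hξ

/-- The continuous extension is bounded on a compact rectangle. The bound is uniform in `ε` and `z`
and needs no boundedness of `v`, so it can serve to prove such boundedness. -/
theorem LaplaceContinues.exists_bound {v : ℝ → ℂ} (h : LaplaceContinues v)
    (hv : ∀ ε : ℝ, 0 < ε → IntegrableOn (fun t => v t * (Real.exp (-ε * t) : ℂ)) (Ioi 0))
    {T : ℝ} (hT : 0 < T) :
    ∃ η : ℝ, 0 < η ∧ ∃ C : ℝ, ∀ ε ∈ Ioc 0 η, ∀ z : ℝ,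
      ‖∫ t in Ioi (0 : ℝ), v t * (Real.exp (-ε * t) : ℂ) * (fejer (T * (t - z)) : ℂ)‖ ≤ C := by
  obtain ⟨η, hη, g, hg, hgL⟩ := h.exists_parseval hv hT
  obtain ⟨C, hC⟩ := (isCompact_Icc.reProdIm isCompact_Icc).exists_bound_of_continuousOn hg
  refine ⟨η, hη, C * |1 - (-1)|, fun ε hε z => ?_⟩
  rw [hgL ε hε z]
  refine intervalIntegral.norm_integral_le_of_norm_le_const fun ξ hξ => ?_
  rw [uIoc_of_le (by norm_num)] at hξ
  have h1 : |ξ| ≤ 1 := abs_le.2 ⟨hξ.1.le, hξ.2⟩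
  have h2 := hC _ (mem_reProdIm_of_mem_Icc (η := η) hT ⟨hε.1.le, hε.2⟩ (Ioc_subset_Icc_self hξ))
  rw [norm_mul, norm_mul, Complex.norm_exp_ofReal_mul_I, mul_one, Complex.norm_real,
    Real.norm_eq_abs, abs_of_nonneg (by linarith)]
  exact (mul_le_of_le_one_left (norm_nonneg _) (by linarith [abs_nonneg ξ])).trans h2

/-- Riemann–Lebesgue for the truncated function. Integrability of `g` is not needed: otherwise the
Bochner integrals are zero. -/
theorem tendsto_integral_triangle_mul {g : ℝ → ℂ} {T : ℝ} (hT : 0 < T) :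
    Tendsto (fun z : ℝ => ∫ ξ in (-1 : ℝ)..1,
      ((1 - |ξ| : ℝ) : ℂ) * Complex.exp ((-(ξ * T * z) : ℝ) * Complex.I) * g ξ) atTop (𝓝 0) := by
  -- The factor `2π` converts to the normalization of `Real.fourierChar`.
  have h1 : Tendsto (fun z : ℝ => T / (2 * Real.pi) * z) atTop (cocompact ℝ) :=
    (tendsto_id.const_mul_atTop (by positivity)).mono_right atTop_le_cocompact
  refine ((Real.tendsto_integral_exp_smul_cocompact
    ((Ioc (-1 : ℝ) 1).indicator fun ξ => ((1 - |ξ| : ℝ) : ℂ) * g ξ)).comp h1).congr fun z => ?_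
  rw [Function.comp, intervalIntegral.integral_of_le (by norm_num),
    ← integral_indicator measurableSet_Ioc]
  refine integral_congr_ae (Eventually.of_forall fun ξ => ?_)
  simp only [indicator]
  split_ifs
  · rw [Circle.smul_def, Real.fourierChar_apply, smul_eq_mul]
    have : 2 * Real.pi * -(ξ * (T / (2 * Real.pi) * z)) = -(ξ * T * z) := by
      field_simp
    rw [this]
    ring
  · simp

/-- Both sides of the damped Parseval identity pass to `ε → 0` by dominated convergence, the
majorants being `M` times the kernel and a constant; Riemann–Lebesgue then applies on the line `ε =
0`. -/
theorem LaplaceContinues.tendsto_integral_mul_fejer {v : ℝ → ℂ} (h : LaplaceContinues v)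
    {M : ℝ} (hM : ∀ t, 0 < t → ‖v t‖ ≤ M)
    (hv : ∀ ε : ℝ, 0 < ε → IntegrableOn (fun t => v t * (Real.exp (-ε * t) : ℂ)) (Ioi 0))
    {T : ℝ} (hT : 0 < T) :
    Tendsto (fun z => ∫ t in Ioi (0 : ℝ), v t * (fejer (T * (t - z)) : ℂ)) atTop (𝓝 0) := by
  obtain ⟨η, hη, g, hg, hgL⟩ := h.exists_parseval hv hT
  obtain ⟨C, hC⟩ := (isCompact_Icc.reProdIm isCompact_Icc).exists_bound_of_continuousOn hg
  refine (tendsto_integral_triangle_mul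
    (g := fun ξ => g (((0 : ℝ) : ℂ) - (ξ * T : ℝ) * Complex.I)) hT).congr fun z => ?_
  have hmem : ∀ᶠ ε in 𝓝[>] (0 : ℝ), ε ∈ Ioc 0 η := Ioc_mem_nhdsGT hη
  have hR : Tendsto (fun ε : ℝ => ∫ ξ in (-1 : ℝ)..1,
      ((1 - |ξ| : ℝ) : ℂ) * Complex.exp ((-(ξ * T * z) : ℝ) * Complex.I) *
          g (ε - (ξ * T : ℝ) * Complex.I)) (𝓝[>] 0) (𝓝 (∫ ξ in (-1 : ℝ)..1,
      ((1 - |ξ| : ℝ) : ℂ) * Complex.exp ((-(ξ * T * z) : ℝ) * Complex.I) *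
          g (((0 : ℝ) : ℂ) - (ξ * T : ℝ) * Complex.I))) := by
    refine intervalIntegral.tendsto_integral_filter_of_dominated_convergence (fun _ => C) ?_ ?_
      intervalIntegrable_const ?_
    · filter_upwards [hmem] with ε hε
      rw [uIoc_of_le (by norm_num)]
      refine ContinuousOn.aestronglyMeasurable (ContinuousOn.mul ?_ ?_) measurableSet_Ioc
      · exact Continuous.continuousOn (by fun_prop)
      · exact (continuousOn_comp_vertical hT ⟨hε.1.le, hε.2⟩ hg).mono Ioc_subset_Icc_self
    · filter_upwards [hmem] with ε hε
      refine Eventually.of_forall fun ξ hξ => ?_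
      rw [uIoc_of_le (by norm_num)] at hξ
      have h1 : |ξ| ≤ 1 := abs_le.2 ⟨hξ.1.le, hξ.2⟩
      have h2 := hC _ (mem_reProdIm_of_mem_Icc (η := η) hT ⟨hε.1.le, hε.2⟩
        (Ioc_subset_Icc_self hξ))
      rw [norm_mul, norm_mul, Complex.norm_exp_ofReal_mul_I, mul_one, Complex.norm_real,
        Real.norm_eq_abs, abs_of_nonneg (by linarith)]
      exact (mul_le_of_le_one_left (norm_nonneg _) (by linarith [abs_nonneg ξ])).trans h2
    · refine Eventually.of_forall fun ξ hξ => ?_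
      rw [uIoc_of_le (by norm_num)] at hξ
      refine Tendsto.const_mul _ ?_
      have h0 := hg _ (mem_reProdIm_of_mem_Icc (η := η) hT ⟨le_rfl, hη.le⟩
        (Ioc_subset_Icc_self hξ))
      refine h0.tendsto.comp (tendsto_nhdsWithin_iff.2 ⟨?_, ?_⟩)
      · have : Continuous fun ε : ℝ => (ε : ℂ) - (ξ * T : ℝ) * Complex.I := by fun_prop
        exact (this.tendsto 0).mono_left nhdsWithin_le_nhds
      · filter_upwards [hmem] with ε hε
        exact mem_reProdIm_of_mem_Icc hT ⟨hε.1.le, hε.2⟩ (Ioc_subset_Icc_self hξ)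
  have hL : Tendsto (fun ε : ℝ =>
      ∫ t in Ioi (0 : ℝ), v t * (Real.exp (-ε * t) : ℂ) * (fejer (T * (t - z)) : ℂ)) (𝓝[>] 0)
      (𝓝 (∫ t in Ioi (0 : ℝ), v t * (fejer (T * (t - z)) : ℂ))) := by
    refine tendsto_integral_filter_of_dominated_convergence (fun t => M * fejer (T * (t - z)))
      ?_ ?_ ?_ ?_
    · filter_upwards [hmem] with ε hε
      exact (hv ε hε.1).aestronglyMeasurable.mul
        (Complex.continuous_ofReal.comp
          (continuous_fejer.comp (by fun_prop : Continuous fun t : ℝ => T * (t - z)))).aestronglyMeasurable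
    · filter_upwards [hmem] with ε hε
      filter_upwards [ae_restrict_mem measurableSet_Ioi] with t ht
      rw [norm_mul, norm_mul, Complex.norm_real, Complex.norm_real, Real.norm_eq_abs,
        Real.norm_eq_abs, abs_of_nonneg (fejer_nonneg _), abs_of_pos (Real.exp_pos _)]
      refine mul_le_mul_of_nonneg_right ?_ (fejer_nonneg _)
      refine (mul_le_of_le_one_right (norm_nonneg _) ?_).trans (hM t ht)
      rw [Real.exp_le_one_iff]
      have := mul_pos hε.1 ht
      linarith
    · exact ((integrable_fejer_comp hT z).const_mul M).restrict
    · refine Eventually.of_forall fun t => ?_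
      have : Continuous fun ε : ℝ =>
        v t * (Real.exp (-ε * t) : ℂ) * (fejer (T * (t - z)) : ℂ) := by fun_prop
      have h0 := (this.tendsto 0).mono_left (nhdsWithin_le_nhds (s := Ioi 0))
      simpa using h0
  refine tendsto_nhds_unique hR (hL.congr' ?_)
  filter_upwards [hmem] with ε hε using hgL ε hε z

end
end MultiTauberian

/-! ### From Fejér averages to pointwise bounds and limits. -/

namespace MultiTauberian
noncomputable section
open MeasureTheory Set Topology

theorem intervalIntegral_fejer_comp {T : ℝ} (hT : 0 < T) (z R : ℝ) :
    ∫ t in (z - R / T)..(z + R / T), fejer (T * (t - z)) = T⁻¹ * ∫ t in (-R)..R, fejer t := by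
  have := intervalIntegral.integral_comp_mul_sub (a := z - R / T) (b := z + R / T)
    fejer hT.ne' (T * z)
  simp_rw [mul_sub]
  rw [this, smul_eq_mul]
  congr 2 <;> field_simp <;> ring

/-- A function bounded by `M` that is at least `ε` on a long enough interval has a Fejér average
that is bounded below. -/
theorem exists_le_integral_mul_fejer {ε : ℝ} (hε : 0 < ε) {M : ℝ} (hM : 0 ≤ M) :
    ∃ R : ℝ, 0 < R ∧ ∀ T : ℝ, 0 < T → ∀ v : ℝ → ℝ,
      AEStronglyMeasurable v (volume.restrict (Ioi 0)) → (∀ t, 0 < t → |v t| ≤ M) →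
      ∀ z, R / T < z → (∀ t ∈ Icc (z - R / T) (z + R / T), ε ≤ v t) →
        T⁻¹ * (ε / 2 * ∫ t, fejer t) ≤ ∫ t in Ioi (0 : ℝ), v t * fejer (T * (t - z)) := by
  have hc := integral_fejer_pos
  have hlim : Tendsto (fun R : ℝ => (ε + M) * ∫ t in (-R)..R, fejer t) atTop
      (𝓝 ((ε + M) * ∫ t, fejer t)) :=
    (intervalIntegral_tendsto_integral integrable_fejer tendsto_neg_atTop_atBot
      tendsto_id).const_mul _
  -- `R` is chosen so that `[-R, R]` carries nearly all the mass of the kernel, the loss being paid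
  -- for by lowering `ε` to `ε / 2`.
  have hlt : (ε / 2 + M) * ∫ t, fejer t < (ε + M) * ∫ t, fejer t := by
    apply mul_lt_mul_of_pos_right _ hc
    linarith
  obtain ⟨R, hR, hR0⟩ := ((hlim.eventually (lt_mem_nhds hlt)).and (eventually_gt_atTop 0)).exists
  refine ⟨R, hR0, fun T hT v hvm hv z hz hvz => ?_⟩
  have hδ : 0 < R / T := div_pos hR0 hT
  have hk := integrable_fejer_comp hT z
  have hI : Icc (z - R / T) (z + R / T) ⊆ Ioi 0 := fun t ht => by
    have := ht.1
    simp only [mem_Ioi]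
    linarith
  -- Adding `M` makes the integrand nonnegative, so the part outside the window can be dropped.
  have h1 : ∫ t in Ioi (0 : ℝ), (v t * fejer (T * (t - z)) + M * fejer (T * (t - z))) =
      (∫ t in Ioi (0 : ℝ), v t * fejer (T * (t - z))) +
        M * ∫ t in Ioi (0 : ℝ), fejer (T * (t - z)) := by
    rw [integral_add, integral_const_mul]
    · refine hk.integrableOn.bdd_mul (c := M) hvm ?_
      filter_upwards [ae_restrict_mem measurableSet_Ioi] with t ht using hv t ht
    · exact (hk.const_mul M).integrableOn
  have h2 : ∫ t in Ioi (0 : ℝ), fejer (T * (t - z)) ≤ T⁻¹ * ∫ t, fejer t := by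
    rw [← integral_fejer_comp hT z]
    exact setIntegral_le_integral hk (Eventually.of_forall fun t => fejer_nonneg _)
  have h3 : (ε + M) * (T⁻¹ * ∫ t in (-R)..R, fejer t) ≤
      ∫ t in Ioi (0 : ℝ), (v t * fejer (T * (t - z)) + M * fejer (T * (t - z))) := by
    rw [← intervalIntegral_fejer_comp hT z R, intervalIntegral.integral_of_le (by linarith),
      ← integral_const_mul, ← integral_Icc_eq_integral_Ioc]
    have hint : IntegrableOn (fun t => v t * fejer (T * (t - z)) + M * fejer (T * (t - z)))
        (Ioi 0) := by
      refine Integrable.add ?_ (hk.const_mul M).integrableOn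
      refine hk.integrableOn.bdd_mul (c := M) hvm ?_
      filter_upwards [ae_restrict_mem measurableSet_Ioi] with t ht using hv t ht
    refine le_trans (setIntegral_mono_on (hk.const_mul _).integrableOn (hint.mono_set hI)
      measurableSet_Icc fun t ht => ?_) (setIntegral_mono_set hint ?_ hI.eventuallyLE)
    · rw [← add_mul]
      exact mul_le_mul_of_nonneg_right (by linarith [hvz t ht]) (fejer_nonneg _)
    · filter_upwards [ae_restrict_mem measurableSet_Ioi] with t ht
      rw [← add_mul]
      exact mul_nonneg (by linarith [abs_le.1 (hv t ht)]) (fejer_nonneg _)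
  have h4 : M * ∫ t in Ioi (0 : ℝ), fejer (T * (t - z)) ≤ M * (T⁻¹ * ∫ t, fejer t) :=
    mul_le_mul_of_nonneg_left h2 hM
  have h5 : T⁻¹ * ((ε / 2 + M) * ∫ t, fejer t) ≤ T⁻¹ * ((ε + M) * ∫ t in (-R)..R, fejer t) :=
    mul_le_mul_of_nonneg_left hR.le (inv_pos.2 hT).le
  have h6 : T⁻¹ * ((ε / 2 + M) * ∫ t, fejer t) =
    T⁻¹ * (ε / 2 * ∫ t, fejer t) + M * (T⁻¹ * ∫ t, fejer t) := by ring
  have h7 : T⁻¹ * ((ε + M) * ∫ t in (-R)..R, fejer t) =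
    (ε + M) * (T⁻¹ * ∫ t in (-R)..R, fejer t) := by ring
  linarith

/-- A slowly decreasing bounded function all of whose Fejér averages tend to zero tends to zero. -/
theorem tendsto_zero_of_fejer_averages {v : ℝ → ℝ}
    (hvm : AEStronglyMeasurable v (volume.restrict (Ioi 0))) {M : ℝ}
    (hv : ∀ t, 0 < t → |v t| ≤ M) (hslow : ∀ y t, 0 < y → y ≤ t → v y - M * (t - y) ≤ v t)
    (hav : ∀ T : ℝ, 0 < T →
      Tendsto (fun z => ∫ t in Ioi (0 : ℝ), v t * fejer (T * (t - z))) atTop (𝓝 0)) :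
    Tendsto v atTop (𝓝 0) := by
  have hM : 0 ≤ M := (abs_nonneg _).trans (hv 1 one_pos)
  refine Metric.tendsto_nhds.2 fun ε hε => ?_
  obtain ⟨R, hR, hRT⟩ := exists_le_integral_mul_fejer (half_pos hε) hM
  -- Over a window of length `2 δ` slow decrease costs at most `ε / 2`; taking `T = R / δ` makes the
  -- window radius `R / T` equal to `δ`.
  obtain ⟨δ, hδ, hδM⟩ : ∃ δ : ℝ, 0 < δ ∧ M * (2 * δ) ≤ ε / 2 := by
    refine ⟨ε / (4 * (M + 1)), by positivity, ?_⟩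
    rw [show M * (2 * (ε / (4 * (M + 1)))) = (M / (M + 1)) * (ε / 2) by field_simp; ring]
    exact mul_le_of_le_one_left (by positivity) ((div_le_one (by positivity)).2 (by linarith))
  have hT : 0 < R / δ := div_pos hR hδ
  have hRδ : R / (R / δ) = δ := by field_simp
  have hpos : 0 < (R / δ)⁻¹ * (ε / 2 / 2 * ∫ t, fejer t) := by
    have := integral_fejer_pos
    positivity
  have hev := Metric.tendsto_nhds.1 (hav _ hT) _ hpos
  obtain ⟨z₀, hz₀⟩ := eventually_atTop.1 hev
  filter_upwards [eventually_gt_atTop (max z₀ 0 + 2 * δ)] with y hy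
  have hy1 : z₀ + 2 * δ < y := (by linarith [le_max_left z₀ 0])
  have hy2 : 2 * δ < y := (by linarith [le_max_right z₀ 0])
  rw [Real.dist_eq, sub_zero, abs_lt]
  constructor
  -- If `v y ≤ -ε`, slow decrease forces `v ≤ -ε / 2` on the window just before `y`, so the average
  -- centred at `y - δ` is too negative. A large positive value propagates forward instead, to the
  -- window centred at `y + δ`.
  · by_contra! hlt
    have h1 := hRT _ hT (fun t => -v t) hvm.neg (fun t ht => by simpa using hv t ht) (y - δ)
      (by rw [hRδ]; linarith) (fun t ht => by
        rw [hRδ] at ht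
        have h2 := hslow t y (by linarith [ht.1]) (by linarith [ht.2])
        have h3 : M * (y - t) ≤ M * (2 * δ) := mul_le_mul_of_nonneg_left (by linarith [ht.1]) hM
        linarith)
    have h4 := hz₀ (y - δ) (by linarith)
    simp_rw [neg_mul] at h1
    rw [integral_neg] at h1
    rw [Real.dist_eq, sub_zero] at h4
    linarith [(abs_lt.1 h4).1]
  · by_contra! hlt
    have h1 := hRT _ hT v hvm hv (y + δ)
      (by rw [hRδ]; linarith) (fun t ht => by
        rw [hRδ] at ht
        have h2 := hslow y t (by linarith) (by linarith [ht.1])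
        have h3 : M * (t - y) ≤ M * (2 * δ) := mul_le_mul_of_nonneg_left (by linarith [ht.2]) hM
        linarith)
    have h4 := hz₀ (y + δ) (by linarith)
    rw [Real.dist_eq, sub_zero] at h4
    linarith [(abs_lt.1 h4).2]

theorem aestronglyMeasurable_mul_exp_neg {S : ℝ → ℝ} (hS : Monotone S) {μ : Measure ℝ} :
    AEStronglyMeasurable (fun t => S t * Real.exp (-t)) μ :=
  (hS.measurable.mul (by fun_prop)).aestronglyMeasurable

/-- The case of a monotone function in the Wiener–Ikehara theorem, once boundedness is known. -/
theorem tendsto_of_monotone_of_fejer_averages {S : ℝ → ℝ} (hS : Monotone S) (hS0 : ∀ t, 0 ≤ S t)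
    {M : ℝ} (hM : ∀ t, 0 < t → S t * Real.exp (-t) ≤ M) {r : ℝ}
    (hav : ∀ T : ℝ, 0 < T → Tendsto (fun z => ∫ t in Ioi (0 : ℝ),
      (S t * Real.exp (-t) - r) * fejer (T * (t - z))) atTop (𝓝 0)) :
    Tendsto (fun t => S t * Real.exp (-t)) atTop (𝓝 r) := by
  have hM0 : 0 ≤ M := (mul_nonneg (hS0 1) (Real.exp_pos _).le).trans (hM 1 one_pos)
  have := tendsto_zero_of_fejer_averages (v := fun t => S t * Real.exp (-t) - r) (M := M + |r|)
    ((aestronglyMeasurable_mul_exp_neg hS).sub aestronglyMeasurable_const) (fun t ht => ?_) ?_ hav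
  · simpa using this.add_const r
  · refine (abs_sub _ _).trans (add_le_add_left ?_ _)
    rw [abs_of_nonneg (mul_nonneg (hS0 t) (Real.exp_pos _).le)]
    exact hM t ht
  · intro y t hy hyt
    -- Slow decrease: `S(t) e^{-t} ≥ S(y) e^{-y} e^{-(t-y)}`, and `e^{-u} ≥ 1 - u`.
    have h1 : S y * Real.exp (-t) ≤ S t * Real.exp (-t) :=
      mul_le_mul_of_nonneg_right (hS hyt) (Real.exp_pos _).le
    have h2 : S y * Real.exp (-t) = S y * Real.exp (-y) * Real.exp (-(t - y)) := by
      rw [mul_assoc, ← Real.exp_add]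
      ring_nf
    have h3 : 1 - (t - y) ≤ Real.exp (-(t - y)) := Real.one_sub_le_exp_neg _
    have h4 : 0 ≤ S y * Real.exp (-y) := mul_nonneg (hS0 y) (Real.exp_pos _).le
    have h5 := mul_le_mul_of_nonneg_left h3 h4
    have h6 := mul_le_mul_of_nonneg_right ((hM y hy).trans (le_add_of_nonneg_right (abs_nonneg r)))
      (sub_nonneg.2 hyt)
    nlinarith

/-- By monotonicity, on `[z, z + 1]` the integrand of the damped average with `T = 1` is at least
`S(z)` times the least value of the exponentials. The average is bounded uniformly in `z` and `ε`,
so letting `ε → 0` bounds `S(z) e^{-z}`. -/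
theorem exists_bound_of_laplaceContinues {S : ℝ → ℝ} (hS : Monotone S) (hS0 : ∀ t, 0 ≤ S t)
    (hint : ∀ ε : ℝ, 0 < ε →
      IntegrableOn (fun t => S t * Real.exp (-t) * Real.exp (-ε * t)) (Ioi 0)) {r : ℂ}
    (hL : LaplaceContinues fun t => ((S t * Real.exp (-t) : ℝ) : ℂ) - r) :
    ∃ M : ℝ, ∀ t, 0 < t → S t * Real.exp (-t) ≤ M := by
  have hexp : ∀ ε : ℝ, 0 < ε → IntegrableOn (fun t => Real.exp (-ε * t)) (Ioi 0) :=
    fun ε hε => exp_neg_integrableOn_Ioi 0 hε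
  obtain ⟨η, hη, C, hC⟩ := hL.exists_bound (T := 1) (fun ε hε => by
    simp_rw [sub_mul]
    refine Integrable.sub ?_ ((hexp ε hε).ofReal.const_mul r)
    simpa using (hint ε hε).ofReal (𝕜 := ℂ)) one_pos
  have hc1 : 0 < ∫ t in (0 : ℝ)..1, fejer t :=
    intervalIntegral.integral_pos one_pos continuous_fejer.continuousOn
      (fun t _ => fejer_nonneg t) ⟨0, by simp, by simp [fejer_zero]⟩
  set c := ∫ t in (0 : ℝ)..1, fejer t with hc
  have hbd : ∀ z, 0 < z → ∀ ε ∈ Ioc 0 η,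
      S z * Real.exp (-(z + 1)) * Real.exp (-ε * (z + 1)) * c ≤ C + |r.re| * ∫ t, fejer t := by
    intro z hz ε hε
    have hk := integrable_fejer_comp one_pos z
    have hk2 := integrable_fejer_comp (T := 1) one_pos z
    have hbk : ∀ f : ℝ → ℝ, IntegrableOn f (Ioi 0) →
        IntegrableOn (fun t => f t * fejer (1 * (t - z))) (Ioi 0) := fun f hf =>
      hf.mul_bdd (c := 2) (continuous_fejer.comp (by fun_prop)).aestronglyMeasurable
        (Eventually.of_forall fun t => abs_fejer_le _)
    have h1 := hC ε hε z
    have h2 : (∫ t in Ioi (0 : ℝ), (((S t * Real.exp (-t) : ℝ) : ℂ) - r) *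
        (Real.exp (-ε * t) : ℂ) * (fejer (1 * (t - z)) : ℂ)).re =
        (∫ t in Ioi (0 : ℝ), S t * Real.exp (-t) * Real.exp (-ε * t) * fejer (1 * (t - z))) -
          r.re * ∫ t in Ioi (0 : ℝ), Real.exp (-ε * t) * fejer (1 * (t - z)) := by
      have hi : IntegrableOn (fun t => (((S t * Real.exp (-t) : ℝ) : ℂ) - r) *
        (Real.exp (-ε * t) : ℂ) * (fejer (1 * (t - z)) : ℂ)) (Ioi 0) := by
        have ha := (hbk _ (hint ε hε.1)).ofReal (𝕜 := ℂ)
        have hb := ((hbk _ (hexp ε hε.1)).ofReal (𝕜 := ℂ)).const_mul r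
        refine (ha.sub hb).congr (Eventually.of_forall fun t => ?_)
        simp
        ring
      rw [← integral_const_mul, ← integral_sub (hbk _ (hint ε hε.1)) ((hbk _ (hexp ε hε.1)).const_mul _)]
      rw [← RCLike.re_eq_complex_re, ← integral_re hi]
      simp only [RCLike.re_eq_complex_re]
      refine integral_congr_ae (Eventually.of_forall fun t => ?_)
      simp only [Complex.re_mul_ofReal, Complex.sub_re, Complex.ofReal_re]
      ring
    have h3 : ∫ t in Ioi (0 : ℝ), Real.exp (-ε * t) * fejer (1 * (t - z)) ≤ ∫ t, fejer t := by
      have := integral_fejer_comp one_pos z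
      rw [inv_one, one_mul] at this
      rw [← this]
      refine le_trans (setIntegral_mono_on (hbk _ (hexp ε hε.1)) hk.integrableOn measurableSet_Ioi
        fun t ht => ?_) (setIntegral_le_integral hk (Eventually.of_forall fun t => fejer_nonneg _))
      refine mul_le_of_le_one_left (fejer_nonneg _) ?_
      rw [Real.exp_le_one_iff]
      have := mul_pos hε.1 (mem_Ioi.1 ht)
      linarith
    have h3' : 0 ≤ ∫ t in Ioi (0 : ℝ), Real.exp (-ε * t) * fejer (1 * (t - z)) :=
      integral_nonneg fun t => mul_nonneg (Real.exp_pos _).le (fejer_nonneg _)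
    have h4 : S z * Real.exp (-(z + 1)) * Real.exp (-ε * (z + 1)) * c ≤
        ∫ t in Ioi (0 : ℝ), S t * Real.exp (-t) * Real.exp (-ε * t) * fejer (1 * (t - z)) := by
      have hcz : c = ∫ t in z..(z + 1), fejer (1 * (t - z)) := by
        have := intervalIntegral.integral_comp_sub_right (a := z) (b := z + 1) fejer z
        simp only [one_mul]
        rw [this, hc]
        congr 1 <;> ring
      have hsub : Ioc z (z + 1) ⊆ Ioi 0 := fun t ht => lt_trans hz ht.1
      rw [hcz, intervalIntegral.integral_of_le (by linarith), ← integral_const_mul]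
      refine le_trans (setIntegral_mono_on (hk.const_mul _).integrableOn
        ((hbk _ (hint ε hε.1)).mono_set hsub) measurableSet_Ioc fun t ht => ?_)
        (setIntegral_mono_set (hbk _ (hint ε hε.1)) ?_ hsub.eventuallyLE)
      · refine mul_le_mul_of_nonneg_right ?_ (fejer_nonneg _)
        refine mul_le_mul (mul_le_mul (hS ht.1.le) (Real.exp_le_exp.2 (by linarith [ht.2]))
          (Real.exp_pos _).le (hS0 t)) (Real.exp_le_exp.2 ?_) (Real.exp_pos _).le
          (mul_nonneg (hS0 t) (Real.exp_pos _).le)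
        nlinarith [ht.2, hε.1]
      · refine Eventually.of_forall fun t => ?_
        exact mul_nonneg (mul_nonneg (mul_nonneg (hS0 t) (Real.exp_pos _).le)
          (Real.exp_pos _).le) (fejer_nonneg _)
    have h5 := (Complex.re_le_norm _).trans h1
    rw [h2] at h5
    have h6 : r.re * ∫ t in Ioi (0 : ℝ), Real.exp (-ε * t) * fejer (1 * (t - z)) ≤
        |r.re| * ∫ t, fejer t :=
      (mul_le_mul_of_nonneg_right (le_abs_self _) h3').trans
        (mul_le_mul_of_nonneg_left h3 (abs_nonneg _))
    linarith
  refine ⟨(C + |r.re| * ∫ t, fejer t) / c * Real.exp 1, fun z hz => ?_⟩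
  have hlim : Tendsto (fun ε : ℝ => S z * Real.exp (-(z + 1)) * Real.exp (-ε * (z + 1)) * c)
      (𝓝[>] 0) (𝓝 (S z * Real.exp (-(z + 1)) * c)) := by
    have : Continuous fun ε : ℝ => S z * Real.exp (-(z + 1)) * Real.exp (-ε * (z + 1)) * c := by
      fun_prop
    simpa using (this.tendsto 0).mono_left nhdsWithin_le_nhds
  have hle := le_of_tendsto hlim (by
    filter_upwards [Ioc_mem_nhdsGT hη] with ε hε using hbd z hz ε hε)
  rw [← le_div_iff₀ hc1] at hle
  have h7 := mul_le_mul_of_nonneg_right hle (Real.exp_pos 1).le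
  rw [mul_assoc, ← Real.exp_add] at h7
  simpa using h7

end
end MultiTauberian

/-! ### The Wiener–Ikehara theorem for Laplace transforms. -/

namespace MultiTauberian
noncomputable section
open MeasureTheory Set Topology

/-- Wiener–Ikehara theorem for a complex function whose increments are dominated by those of a
real one, in terms of Laplace transforms. -/
theorem tendsto_of_laplaceContinues {S : ℝ → ℂ} {S' : ℝ → ℝ}
    (hinc : ∀ y t, y ≤ t → ‖S t - S y‖ ≤ S' t - S' y) (hSS' : ∀ t, ‖S t‖ ≤ S' t)
    (hint : ∀ ε : ℝ, 0 < ε →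
      IntegrableOn (fun t => S' t * Real.exp (-t) * Real.exp (-ε * t)) (Ioi 0)) {r r' : ℂ}
    (hL : LaplaceContinues fun t => S t * (Real.exp (-t) : ℂ) - r)
    (hL' : LaplaceContinues fun t => ((S' t * Real.exp (-t) : ℝ) : ℂ) - r') :
    Tendsto (fun t => S t * (Real.exp (-t) : ℂ)) atTop (𝓝 r) ∧
      ∃ M : ℝ, ∀ t, 0 < t → S' t * Real.exp (-t) ≤ M := by
  have hS' : Monotone S' := fun y t h => sub_nonneg.1 ((norm_nonneg _).trans (hinc y t h))
  have hS'0 : ∀ t, 0 ≤ S' t := fun t => (norm_nonneg _).trans (hSS' t)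
  obtain ⟨M, hM⟩ := exists_bound_of_laplaceContinues hS' hS'0 hint hL'
  refine ⟨?_, M, hM⟩
  -- Reduction to the monotone case: for a real functional `φ` of norm at most one, `S' + φ ∘ S` is
  -- monotone and nonnegative. Its limit minus that of `S'` gives `φ r`; real and imaginary parts
  -- suffice.
  have hmono : ∀ φ : ℂ →L[ℝ] ℝ, (∀ z, |φ z| ≤ ‖z‖) → Monotone fun t => S' t + φ (S t) := by
    intro φ hφ y t h
    have h1 := (abs_le.1 ((hφ _).trans (hinc y t h))).1
    rw [map_sub] at h1
    show S' y + φ (S y) ≤ S' t + φ (S t)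
    linarith
  have hmeasφ : ∀ φ : ℂ →L[ℝ] ℝ, (∀ z, |φ z| ≤ ‖z‖) → Measurable fun t => φ (S t) := by
    intro φ hφ
    convert! (hmono φ hφ).measurable.sub hS'.measurable using 1
    funext t
    simp
  have hSm : Measurable S := by
    have h1 := hmeasφ Complex.reCLM Complex.abs_re_le_norm
    have h2 := hmeasφ Complex.imCLM Complex.abs_im_le_norm
    have : S = fun t => ((Complex.reCLM (S t) : ℝ) : ℂ) + ((Complex.imCLM (S t) : ℝ) : ℂ) * Complex.I := by
      funext t
      simp [Complex.re_add_im]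
    rw [this]
    fun_prop
  have hexpm : Measurable fun t : ℝ => (Real.exp (-t) : ℂ) := by fun_prop
  have hbd : ∀ t, 0 < t → ‖S t * (Real.exp (-t) : ℂ)‖ ≤ M := fun t ht => by
    rw [norm_mul, Complex.norm_real, Real.norm_eq_abs, abs_of_pos (Real.exp_pos _)]
    exact (mul_le_mul_of_nonneg_right (hSS' t) (Real.exp_pos _).le).trans (hM t ht)
  have hbd' : ∀ t, 0 < t → ‖((S' t * Real.exp (-t) : ℝ) : ℂ)‖ ≤ M := fun t ht => by
    rw [Complex.norm_real, Real.norm_eq_abs,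
      abs_of_nonneg (mul_nonneg (hS'0 t) (Real.exp_pos _).le)]
    exact hM t ht
  have key : ∀ (v : ℝ → ℂ) (ρ : ℂ), Measurable v → (∀ t, 0 < t → ‖v t‖ ≤ M) →
      LaplaceContinues (fun t => v t - ρ) → ∀ φ : ℂ →L[ℝ] ℝ, ∀ T : ℝ, 0 < T →
      Tendsto (fun z => ∫ t in Ioi (0 : ℝ), (φ (v t) - φ ρ) * fejer (T * (t - z))) atTop (𝓝 0) := by
    intro v ρ hvm hv hvL φ T hT
    have hvb : ∀ t, 0 < t → ‖v t - ρ‖ ≤ M + ‖ρ‖ := fun t ht =>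
      (norm_sub_le _ _).trans (add_le_add_left (hv t ht) _)
    have h1 := hvL.tendsto_integral_mul_fejer hvb (fun ε hε => by
      refine Integrable.bdd_mul (c := M + ‖ρ‖) (exp_neg_integrableOn_Ioi 0 hε).ofReal
        (hvm.sub_const ρ).aestronglyMeasurable ?_
      filter_upwards [ae_restrict_mem measurableSet_Ioi] with t ht using hvb t ht) hT
    have h2 := (φ.continuous.tendsto 0).comp h1
    rw [map_zero] at h2
    refine h2.congr fun z => ?_
    rw [Function.comp, ← φ.integral_comp_comm]
    · refine integral_congr_ae (Eventually.of_forall fun t => ?_)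
      simp only
      rw [mul_comm, ← Complex.real_smul, map_smul, smul_eq_mul, map_sub, mul_comm]
    · refine Integrable.bdd_mul (c := M + ‖ρ‖) (integrable_fejer_comp hT z).ofReal.restrict
        (hvm.sub_const ρ).aestronglyMeasurable ?_
      filter_upwards [ae_restrict_mem measurableSet_Ioi] with t ht using hvb t ht
  have hm' : Measurable fun t => ((S' t * Real.exp (-t) : ℝ) : ℂ) :=
    Complex.measurable_ofReal.comp (hS'.measurable.mul (by fun_prop))
  have hav' := key _ r' hm' hbd' hL' Complex.reCLM
  have hlim' := tendsto_of_monotone_of_fejer_averages hS' hS'0 hM (r := r'.re) hav'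
  have hlim : ∀ φ : ℂ →L[ℝ] ℝ, (∀ z, |φ z| ≤ ‖z‖) →
      Tendsto (fun t => φ (S t * (Real.exp (-t) : ℂ))) atTop (𝓝 (φ r)) := by
    intro φ hφ
    have hφS : ∀ t, φ (S t * (Real.exp (-t) : ℂ)) = φ (S t) * Real.exp (-t) := fun t => by
      rw [mul_comm, ← Complex.real_smul, map_smul, smul_eq_mul, mul_comm]
    have h1 := tendsto_of_monotone_of_fejer_averages (hmono φ hφ) (M := M + M) (r := r'.re + φ r)
      (fun t => by linarith [(abs_le.1 ((hφ _).trans (hSS' t))).1])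
      (fun t ht => by
        rw [add_mul]
        refine add_le_add (hM t ht) ?_
        rw [← hφS]
        exact (le_abs_self _).trans ((hφ _).trans (hbd t ht)))
      (fun T hT => by
        have h2 := (hav' T hT).add (key (fun t => S t * (Real.exp (-t) : ℂ)) r (hSm.mul hexpm) hbd hL φ T hT)
        rw [add_zero] at h2
        refine h2.congr fun z => ?_
        have hi : ∀ (v : ℝ → ℂ) (ρ : ℂ), Measurable v → (∀ t, 0 < t → ‖v t‖ ≤ M) →
            ∀ φ : ℂ →L[ℝ] ℝ, (∀ z, |φ z| ≤ ‖z‖) →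
            IntegrableOn (fun t => (φ (v t) - φ ρ) * fejer (T * (t - z))) (Ioi 0) := by
          intro v ρ hvm hv φ hφ
          refine Integrable.bdd_mul (c := M + |φ ρ|) (integrable_fejer_comp hT z).restrict
            ((φ.continuous.measurable.comp hvm).sub_const _).aestronglyMeasurable ?_
          filter_upwards [ae_restrict_mem measurableSet_Ioi] with t ht
          exact (norm_sub_le _ _).trans (add_le_add_left ((hφ _).trans (hv t ht)) _)
        rw [← integral_add (hi _ _ hm' hbd' _ Complex.abs_re_le_norm)
          (hi (fun t => S t * (Real.exp (-t) : ℂ)) _ (hSm.mul hexpm) hbd φ hφ)]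
        refine integral_congr_ae (Eventually.of_forall fun t => ?_)
        simp only [hφS, Complex.reCLM_apply, Complex.ofReal_re, add_mul]
        ring)
    have h3 := h1.sub hlim'
    rw [add_sub_cancel_left] at h3
    refine h3.congr fun t => ?_
    rw [hφS]
    ring
  have h1 := hlim Complex.reCLM Complex.abs_re_le_norm
  have h2 := hlim Complex.imCLM Complex.abs_im_le_norm
  have h3 := ((Complex.continuous_ofReal.tendsto _).comp h1).add
    (((Complex.continuous_ofReal.tendsto _).comp h2).mul_const Complex.I)
  simp only [Complex.reCLM_apply, Complex.imCLM_apply, Complex.re_add_im, Function.comp_def] at h3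
  exact h3

/-- `(s - 1) f(s)`, defined for `Re s > 1`, continues analytically to a neighbourhood of the line
`Re s = 1`, with value `r` at `s = 1`. -/
def ContinuesToLine (f : ℂ → ℂ) (r : ℂ) : Prop :=
  ∃ g : ℂ → ℂ, (∀ s : ℂ, s.re = 1 → AnalyticAt ℂ g s ∧
    ∀ᶠ z in 𝓝 s, 1 < z.re → g z = (z - 1) * f z) ∧ g 1 = r

/-- With `G s = g s / s`, the transform of `v - r` at `w` is `f(1 + w) / (1 + w) - r / w = (G(1 + w)
- G(1)) / w`. This difference quotient extends continuously over `w = 0`, so the pole cancels. -/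
theorem laplaceContinues_of_continuesToLine {f : ℂ → ℂ} {r : ℂ} (h : ContinuesToLine f r)
    {v : ℝ → ℂ} (hint : ∀ w : ℂ, 0 < w.re →
      IntegrableOn (fun t : ℝ => v t * Complex.exp (-w * t)) (Ioi 0))
    (hv : ∀ w : ℂ, 0 < w.re →
      ∫ t in Ioi (0 : ℝ), v t * Complex.exp (-w * t) = f (1 + w) / (1 + w)) :
    LaplaceContinues fun t => v t - r := by
  obtain ⟨g, hg, hg1⟩ := h
  intro T hT
  set G : ℂ → ℂ := fun s => g s / s with hG
  have hG1 : G 1 = r := by simp [hG, hg1]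
  have hGan : ∀ s : ℂ, s.re = 1 → AnalyticAt ℂ G s := fun s hs =>
    (hg s hs).1.div analyticAt_id (by rintro rfl; simp at hs)
  have hcont : ∀ s : ℂ, AnalyticAt ℂ G s → ContinuousAt (dslope G 1) s := by
    intro s hs
    by_cases h1 : s = 1
    · subst h1
      exact continuousAt_dslope_same.2 hs.differentiableAt
    · exact (continuousAt_dslope_of_ne h1).2 hs.continuousAt
  have hval : ∀ w : ℂ, 0 < w.re → g (1 + w) = (1 + w - 1) * f (1 + w) →
      ∫ t in Ioi (0 : ℝ), (v t - r) * Complex.exp (-w * t) = dslope G 1 (1 + w) := by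
    intro w hw hgw
    have hw0 : w ≠ 0 := by rintro rfl; simp at hw
    have hw1 : 1 + w ≠ 0 := by
      intro h0
      have := congrArg Complex.re h0
      simp at this
      linarith
    have hexp := integrableOn_exp_mul_complex_Ioi (a := -w) (by simpa using hw) 0
    simp_rw [sub_mul]
    rw [integral_sub (hint w hw) (hexp.const_mul r), integral_const_mul,
      integral_exp_mul_complex_Ioi (by simpa using hw), hv w hw,
      dslope_of_ne _ (by simpa using hw0), slope_def_field, hG1, hG]
    simp only [hgw, add_sub_cancel_left, Complex.ofReal_zero, mul_zero, Complex.exp_zero]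
    field_simp
  -- The continuation is only local at each boundary point; compactness of `[-T, T]` yields one
  -- width for all heights.
  have hev : ∀ᶠ ε : ℝ in 𝓝 0, ∀ τ ∈ Icc (-T) T,
      ContinuousAt (dslope G 1) (1 + (ε + τ * Complex.I)) ∧
        (1 < (1 + (ε + τ * Complex.I) : ℂ).re → g (1 + (ε + τ * Complex.I)) =
          (1 + (ε + τ * Complex.I) - 1) * f (1 + (ε + τ * Complex.I))) := by
    refine isCompact_Icc.eventually_forall_of_forall_eventually fun τ _ => ?_
    have hre : (1 + ((0 : ℝ) + τ * Complex.I) : ℂ).re = 1 := by simp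
    have hφ : Continuous fun z : ℝ × ℝ => (1 + (z.1 + z.2 * Complex.I) : ℂ) := by fun_prop
    exact (hφ.tendsto (0, τ)).eventually
      (((hGan _ hre).eventually_analyticAt.mono hcont).and (hg _ hre).2)
  obtain ⟨η, hη, hηP⟩ := Metric.eventually_nhds_iff.1 hev
  have hdec : ∀ w ∈ Icc 0 (η / 2) ×ℂ Icc (-T) T, dist w.re 0 < η ∧ w.im ∈ Icc (-T) T ∧
      (w.re + w.im * Complex.I : ℂ) = w := by
    intro w hw
    rw [Complex.mem_reProdIm] at hw
    refine ⟨?_, hw.2, Complex.re_add_im w⟩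
    rw [Real.dist_eq, sub_zero, abs_of_nonneg hw.1.1]
    linarith [hw.1.2]
  refine ⟨η / 2, half_pos hη, fun w => dslope G 1 (1 + w), ?_, ?_⟩
  · intro w hw
    obtain ⟨h1, h2, h3⟩ := hdec w hw
    have h4 := (hηP h1 _ h2).1
    rw [h3] at h4
    exact (ContinuousAt.comp (f := fun w : ℂ => 1 + w) h4 (by fun_prop)).continuousWithinAt
  · intro w hw hpos
    obtain ⟨h1, h2, h3⟩ := hdec w hw
    have h4 := (hηP h1 _ h2).2
    rw [h3] at h4
    exact hval w hpos (h4 (by simpa using hpos))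

end
end MultiTauberian

/-! ### The Wiener–Ikehara theorem for general Dirichlet series. -/

namespace MultiTauberian
noncomputable section
open MeasureTheory Set Topology

/-- The summatory function of the coefficients `a j` placed at the points `l j`. -/
def sumLe {J E : Type*} [AddCommMonoid E] [TopologicalSpace E] (a : J → E) (l : J → ℝ) (x : ℝ) : E :=
  ∑' j, {j | l j ≤ x}.indicator a j

variable {J : Type*} {l : J → ℝ}

/-- Rankin's trick with exponent `2`: the condition `l j ≤ x` gives `1 ≤ (x / l j) ^ 2`. -/
theorem summable_indicator_norm {E : Type*} [NormedAddCommGroup E] {a : J → E}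
    (hl : ∀ j, 1 ≤ l j) (hs : ∀ σ : ℝ, 1 < σ → Summable fun j => ‖a j‖ * l j ^ (-σ)) (x : ℝ) :
    Summable fun j => ‖{j | l j ≤ x}.indicator a j‖ := by
  refine ((hs 2 one_lt_two).mul_left (x ^ (2 : ℝ))).of_nonneg_of_le (fun _ => norm_nonneg _) fun j => ?_
  have hl0 : 0 < l j := one_pos.trans_le (hl j)
  by_cases hj : l j ≤ x
  · rw [indicator_of_mem (show j ∈ {j | l j ≤ x} from hj), mul_left_comm, Real.rpow_neg hl0.le,
      ← div_eq_mul_inv]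
    exact le_mul_of_one_le_right (norm_nonneg _)
      ((one_le_div (Real.rpow_pos_of_pos hl0 _)).2 (Real.rpow_le_rpow hl0.le hj zero_le_two))
  · rw [indicator_of_notMem (show j ∉ {j | l j ≤ x} from hj), norm_zero]
    rcases lt_or_ge x 0 with hx | hx
    · rw [Real.rpow_two]
      positivity
    · positivity

theorem norm_sumLe_sub_le {a : J → ℂ} {a' : J → ℝ} (ha : ∀ j, ‖a j‖ ≤ a' j)
    (hl : ∀ j, 1 ≤ l j) (hs : ∀ σ : ℝ, 1 < σ → Summable fun j => a' j * l j ^ (-σ))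
    {x y : ℝ} (hxy : x ≤ y) :
    ‖sumLe a l y - sumLe a l x‖ ≤ sumLe a' l y - sumLe a' l x := by
  have h0 : ∀ j, 0 ≤ a' j := fun j => (norm_nonneg _).trans (ha j)
  have hsn' : ∀ σ : ℝ, 1 < σ → Summable fun j => ‖a' j‖ * l j ^ (-σ) := by
    simpa only [Real.norm_eq_abs, abs_of_nonneg (h0 _)] using hs
  have hsn : ∀ σ : ℝ, 1 < σ → Summable fun j => ‖a j‖ * l j ^ (-σ) := fun σ hσ =>
    (hs σ hσ).of_nonneg_of_le
      (fun j => mul_nonneg (norm_nonneg _) (Real.rpow_nonneg (by linarith [hl j]) _))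
      fun j => mul_le_mul_of_nonneg_right (ha j) (Real.rpow_nonneg (by linarith [hl j]) _)
  have h1 := fun x => (summable_indicator_norm hl hsn x).of_norm
  have h2 := fun x => (summable_indicator_norm hl hsn' x).of_norm
  rw [sumLe, sumLe, sumLe, sumLe, ← (h1 y).tsum_sub (h1 x), ← (h2 y).tsum_sub (h2 x)]
  refine tsum_of_norm_bounded ((h2 y).sub (h2 x)).hasSum fun j => ?_
  by_cases hx : l j ≤ x
  · simp [indicator, hx, hx.trans hxy]
  · by_cases hy : l j ≤ y
    · simpa [indicator, hx, hy] using ha j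
    · simp [indicator, hx, hy]

theorem sumLe_of_lt_one {E : Type*} [AddCommMonoid E] [TopologicalSpace E] (a : J → E)
    (hl : ∀ j, 1 ≤ l j) {x : ℝ} (hx : x < 1) : sumLe a l x = 0 := by
  have : ∀ j, {j | l j ≤ x}.indicator a j = 0 := fun j =>
    indicator_of_notMem (show j ∉ {j | l j ≤ x} from fun (h : l j ≤ x) => by linarith [hl j]) _
  simp [sumLe, this]

theorem norm_sumLe_le {a : J → ℂ} {a' : J → ℝ} (ha : ∀ j, ‖a j‖ ≤ a' j)
    (hl : ∀ j, 1 ≤ l j) (hs : ∀ σ : ℝ, 1 < σ → Summable fun j => a' j * l j ^ (-σ)) (x : ℝ) :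
    ‖sumLe a l x‖ ≤ sumLe a' l x := by
  rcases le_total 0 x with hx | hx
  · simpa [sumLe_of_lt_one _ hl zero_lt_one] using norm_sumLe_sub_le ha hl hs hx
  · simp [sumLe_of_lt_one _ hl (lt_of_le_of_lt hx zero_lt_one)]

/-- Laplace transform of the summatory function of a Dirichlet series. -/
theorem laplace_sumLe [Countable J] {a : J → ℂ} (hl : ∀ j, 1 ≤ l j)
    (hs : ∀ σ : ℝ, 1 < σ → Summable fun j => ‖a j‖ * l j ^ (-σ)) {w : ℂ} (hw : 0 < w.re) :
    ∫ t in Ioi (0 : ℝ), sumLe a l (Real.exp t) * (Real.exp (-t) : ℂ) * Complex.exp (-w * t) =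
      (∑' j, a j * (l j : ℂ) ^ (-(1 + w))) / (1 + w) := by
  have hl0 : ∀ j, 0 < l j := fun j => one_pos.trans_le (hl j)
  have hre : (-(1 + w)).re < 0 := by simp; linarith
  have hre' : (-(1 + w.re)) < 0 := by linarith
  set F : J → ℝ → ℂ := fun j =>
    (Ici (Real.log (l j))).indicator fun t => a j * Complex.exp (-(1 + w) * t) with hF
  -- When `l j = 1` the jump sits at the endpoint `t = 0`, so the two sets agree only up to a null
  -- set.
  have hset : ∀ j, (Ioi (0 : ℝ) ∩ Ici (Real.log (l j)) : Set ℝ) =ᵐ[volume] Ioi (Real.log (l j)) := by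
    intro j
    rcases (Real.log_nonneg (hl j)).eq_or_lt with h | h
    · rw [← h, inter_eq_left.2 Ioi_subset_Ici_self]
      exact ae_eq_refl _
    · have : Ioi (0 : ℝ) ∩ Ici (Real.log (l j)) = Ici (Real.log (l j)) :=
        inter_eq_right.2 fun t (ht : _ ≤ t) => lt_of_lt_of_le h ht
      rw [this]
      exact Ioi_ae_eq_Ici.symm
  have hpow : ∀ j, (l j : ℂ) ^ (-(1 + w)) = Complex.exp (-(1 + w) * Real.log (l j)) := by
    intro j
    rw [Complex.cpow_def_of_ne_zero (by exact_mod_cast (hl0 j).ne'), Complex.ofReal_log (hl0 j).le,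
      mul_comm]
  have hFint : ∀ j, IntegrableOn (F j) (Ioi 0) := fun j => by
    have := ((integrableOn_exp_mul_complex_Ioi hre (Real.log (l j))).const_mul (a j))
    exact (((integrableOn_Ici_iff_integrableOn_Ioi enorm_ne_top).2 this).integrable_indicator
      measurableSet_Ici).integrableOn
  have hFval : ∀ j, ∫ t in Ioi (0 : ℝ), F j t = a j * (l j : ℂ) ^ (-(1 + w)) / (1 + w) := by
    intro j
    rw [hF, setIntegral_indicator measurableSet_Ici, setIntegral_congr_set (hset j),
      integral_const_mul, integral_exp_mul_complex_Ioi hre, hpow]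
    rw [neg_div_neg_eq, mul_div_assoc]
  have hFnorm : ∀ j, ∫ t in Ioi (0 : ℝ), ‖F j t‖ = ‖a j‖ * l j ^ (-(1 + w.re)) / (1 + w.re) := by
    intro j
    have : ∀ t, ‖F j t‖ = (Ici (Real.log (l j))).indicator
        (fun t => ‖a j‖ * Real.exp (-(1 + w.re) * t)) t := fun t => by
      rw [hF, norm_indicator_eq_indicator_norm]
      congr 1
      funext t
      rw [norm_mul, Complex.norm_exp]
      simp
    simp_rw [this]
    rw [setIntegral_indicator measurableSet_Ici, setIntegral_congr_set (hset j),
      integral_const_mul, integral_exp_mul_Ioi hre', Real.rpow_def_of_pos (hl0 j), neg_div_neg_eq,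
      mul_div_assoc, mul_comm (Real.log _)]
  have hsum := hasSum_integral_of_summable_integral_norm (μ := volume.restrict (Ioi 0)) hFint (by
    simp_rw [hFnorm]
    exact (hs (1 + w.re) (by linarith)).div_const _)
  rw [← tsum_div_const]
  simp_rw [← hFval]
  rw [hsum.tsum_eq]
  refine integral_congr_ae (Eventually.of_forall fun t => ?_)
  simp only
  rw [mul_assoc, Complex.ofReal_exp, ← Complex.exp_add, sumLe, ← tsum_mul_right]
  refine tsum_congr fun j => ?_
  have hiff : l j ≤ Real.exp t ↔ Real.log (l j) ≤ t := (Real.log_le_iff_le_exp (hl0 j)).symm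
  have hexp : (((-t : ℝ) : ℂ) + -w * t) = -(1 + w) * t := by push_cast; ring
  rw [hexp]
  by_cases h : Real.log (l j) ≤ t
  · simp [hF, indicator, hiff, h]
  · simp [hF, indicator, hiff, h]

/-- Rankin's trick again, now with `σ` arbitrarily close to `1`, to make the Laplace integrals
converge in `Re w > 0`. -/
theorem sumLe_le_rpow {a : J → ℝ} (ha : ∀ j, 0 ≤ a j) (hl : ∀ j, 1 ≤ l j)
    (hs : ∀ σ : ℝ, 1 < σ → Summable fun j => a j * l j ^ (-σ)) {σ : ℝ} (hσ : 1 < σ) {x : ℝ}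
    (hx : 0 ≤ x) : sumLe a l x ≤ x ^ σ * ∑' j, a j * l j ^ (-σ) := by
  rw [sumLe, ← tsum_mul_left]
  have hsn : ∀ σ : ℝ, 1 < σ → Summable fun j => ‖a j‖ * l j ^ (-σ) := by
    simpa only [Real.norm_eq_abs, abs_of_nonneg (ha _)] using hs
  refine (summable_indicator_norm hl hsn x).of_norm.tsum_le_tsum (fun j => ?_) ((hs σ hσ).mul_left _)
  have hl0 : 0 < l j := one_pos.trans_le (hl j)
  by_cases hj : l j ≤ x
  · rw [indicator_of_mem (show j ∈ {j | l j ≤ x} from hj), mul_left_comm, Real.rpow_neg hl0.le,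
      ← div_eq_mul_inv]
    exact le_mul_of_one_le_right (ha j)
      ((one_le_div (Real.rpow_pos_of_pos hl0 _)).2 (Real.rpow_le_rpow hl0.le hj (by linarith)))
  · rw [indicator_of_notMem (show j ∉ {j | l j ≤ x} from hj)]
    have := ha j
    positivity

/-- The Wiener–Ikehara theorem for a general Dirichlet series with complex coefficients, dominated
by a Dirichlet series with nonnegative coefficients. -/
theorem wienerIkehara [Countable J] {a : J → ℂ} {a' : J → ℝ} (ha : ∀ j, ‖a j‖ ≤ a' j)
    (hl : ∀ j, 1 ≤ l j) (hs : ∀ σ : ℝ, 1 < σ → Summable fun j => a' j * l j ^ (-σ)) {r r' : ℂ}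
    (h : ContinuesToLine (fun s => ∑' j, a j * (l j : ℂ) ^ (-s)) r)
    (h' : ContinuesToLine (fun s => ∑' j, (a' j : ℂ) * (l j : ℂ) ^ (-s)) r') :
    Tendsto (fun x => sumLe a l x / x) atTop (𝓝 r) ∧ ∃ M, ∀ x, ‖sumLe a l x‖ ≤ M * |x| := by
  have h0 : ∀ j, 0 ≤ a' j := fun j => (norm_nonneg _).trans (ha j)
  have hsn : ∀ σ : ℝ, 1 < σ → Summable fun j => ‖a j‖ * l j ^ (-σ) := fun σ hσ =>
    (hs σ hσ).of_nonneg_of_le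
      (fun j => mul_nonneg (norm_nonneg _) (Real.rpow_nonneg (by linarith [hl j]) _))
      fun j => mul_le_mul_of_nonneg_right (ha j) (Real.rpow_nonneg (by linarith [hl j]) _)
  have hsn' : ∀ σ : ℝ, 1 < σ → Summable fun j => ‖(a' j : ℂ)‖ * l j ^ (-σ) := by
    simpa only [Complex.norm_real, Real.norm_eq_abs, abs_of_nonneg (h0 _)] using hs
  have hinc : ∀ y t, y ≤ t → ‖sumLe a l (Real.exp t) - sumLe a l (Real.exp y)‖ ≤
      sumLe a' l (Real.exp t) - sumLe a' l (Real.exp y) := fun y t hyt =>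
    norm_sumLe_sub_le ha hl hs (Real.exp_le_exp.2 hyt)
  have hle : ∀ t, ‖sumLe a l (Real.exp t)‖ ≤ sumLe a' l (Real.exp t) :=
    fun t => norm_sumLe_le ha hl hs _
  have hmono : Monotone fun t => sumLe a' l (Real.exp t) := fun y t hyt =>
    sub_nonneg.1 ((norm_nonneg _).trans (hinc y t hyt))
  have hint : ∀ ε : ℝ, 0 < ε → IntegrableOn
      (fun t => sumLe a' l (Real.exp t) * Real.exp (-t) * Real.exp (-ε * t)) (Ioi 0) := by
    intro ε hε
    -- With exponent `1 + ε / 2` half of the damping survives: the integrand is at most a constant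
    -- times `exp (-ε t / 2)`.
    refine ((exp_neg_integrableOn_Ioi 0 (half_pos hε)).const_mul
      (∑' j, a' j * l j ^ (-(1 + ε / 2)))).mono'
      ((hmono.measurable.mul (by fun_prop)).mul (by fun_prop)).aestronglyMeasurable
      (Eventually.of_forall fun t => ?_)
    have h1 := sumLe_le_rpow h0 hl hs (σ := 1 + ε / 2) (by linarith) (Real.exp_pos t).le
    have h2 : 0 ≤ sumLe a' l (Real.exp t) := (norm_nonneg _).trans (hle t)
    rw [Real.norm_eq_abs, abs_of_nonneg (by positivity), mul_assoc, ← Real.exp_add]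
    refine (mul_le_mul_of_nonneg_right h1 (Real.exp_pos _).le).trans (le_of_eq ?_)
    rw [← Real.exp_mul, mul_right_comm, ← Real.exp_add, mul_comm]
    ring_nf
  have hcast : ∀ x, ((sumLe a' l x : ℝ) : ℂ) = sumLe (fun j => (a' j : ℂ)) l x := fun x => by
    rw [sumLe, sumLe, Complex.ofReal_tsum]
    refine tsum_congr fun j => ?_
    by_cases hj : l j ≤ x <;> simp [indicator, hj]
  have hSm : ∀ b : J → ℂ, (∀ j, ‖b j‖ ≤ a' j) → ∀ w : ℂ, 0 < w.re → IntegrableOn (fun t : ℝ =>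
      sumLe b l (Real.exp t) * (Real.exp (-t) : ℂ) * Complex.exp (-w * t)) (Ioi 0) := by
    intro b hb w hw
    have hm : Measurable fun t => sumLe b l (Real.exp t) := by
      refine Measurable.tsum fun j => ?_
      have : (fun t => {j | l j ≤ Real.exp t}.indicator b j) =
          {t | l j ≤ Real.exp t}.indicator fun _ => b j := by
        funext t
        simp [indicator]
      rw [this]
      exact measurable_const.indicator (measurableSet_le measurable_const Real.measurable_exp)
    refine (hint w.re hw).mono' ((hm.mul (by fun_prop)).mul (by fun_prop)).aestronglyMeasurable
      (Eventually.of_forall fun t => ?_)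
    rw [norm_mul, norm_mul, Complex.norm_exp, Complex.norm_real, Real.norm_eq_abs,
      abs_of_pos (Real.exp_pos _)]
    have : (-w * t).re = -w.re * t := by simp
    rw [this]
    gcongr
    exact norm_sumLe_le hb hl hs _
  have hab' : ∀ j, ‖(a' j : ℂ)‖ ≤ a' j := fun j => by
    rw [Complex.norm_real, Real.norm_eq_abs, abs_of_nonneg (h0 j)]
  have hL := laplaceContinues_of_continuesToLine h (hSm a ha) fun w hw => laplace_sumLe hl hsn hw
  have hL' := laplaceContinues_of_continuesToLine h' (hSm _ hab')
    fun w hw => laplace_sumLe hl hsn' hw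
  obtain ⟨hlim, M, hM⟩ := tendsto_of_laplaceContinues hinc hle hint hL (by
    simpa only [Complex.ofReal_mul, hcast] using hL')
  constructor
  · refine (hlim.comp Real.tendsto_log_atTop).congr' ?_
    filter_upwards [eventually_gt_atTop 0] with x hx
    rw [Function.comp, Real.exp_neg, Real.exp_log hx, Complex.ofReal_inv, div_eq_mul_inv]
  -- The bound `M` holds only for `t > 0`, while `log x = 0` at `x = 1`; evaluating at `log x + 1`
  -- costs a factor `e`.
  · refine ⟨M * Real.exp 1, fun x => ?_⟩
    have hM0 : 0 ≤ M := (mul_nonneg ((norm_nonneg _).trans (hle 1)) (Real.exp_pos _).le).trans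
      (hM 1 one_pos)
    rcases lt_or_ge x 1 with hx | hx
    · rw [sumLe_of_lt_one _ hl hx, norm_zero]
      positivity
    · have hx0 : 0 < x := by linarith
      have h1 : sumLe a' l x ≤ sumLe a' l (Real.exp (Real.log x + 1)) := by
        have := hmono (show Real.log x ≤ Real.log x + 1 by linarith)
        simpa only [Real.exp_log hx0] using this
      have h2 := hM (Real.log x + 1) (by linarith [Real.log_nonneg hx])
      rw [Real.exp_neg, ← div_eq_mul_inv, div_le_iff₀ (Real.exp_pos _)] at h2
      rw [abs_of_pos hx0]
      refine (norm_sumLe_le ha hl hs x).trans (h1.trans (h2.trans (le_of_eq ?_)))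
      rw [Real.exp_add, Real.exp_log hx0]
      ring

end
end MultiTauberian

/-! ### Convergence of sums over primes. -/

namespace MultiTauberian
noncomputable section
open Set Topology

variable {K : Type*} [Field K] [NumberField K]

instance countable_Pr : Countable (Pr K) := by
  have : (Set.univ : Set (Pr K)) = ⋃ n : ℕ, {p : Pr K | (Nm p : ℝ) ≤ n} := by
    ext p
    simp only [mem_univ, mem_iUnion, true_iff]
    exact ⟨Nm p, (le_refl _ : (Nm p : ℝ) ≤ Nm p)⟩
  rw [← Set.countable_univ_iff, this]
  exact Set.countable_iUnion fun n => (finite_Nm_le _).countable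

/-- Primes of norm at most `n` inject into the nonzero ideals of norm at most `n`, whose number is
`O(n)`. Partial summation for the series counting primes by norm gives convergence for `σ > 1`. -/
theorem summable_Nm_rpow {σ : ℝ} (hσ : 1 < σ) : Summable fun p : Pr K => (Nm p : ℝ) ^ (-σ) := by
  classical
  have hfin : ∀ n : ℕ, {p : Pr K | Nm p = n}.Finite := fun n =>
    (finite_Nm_le (K := K) n).subset fun p (hp : Nm p = n) => by simp [hp]
  set f : ℕ → ℝ := fun n => ((hfin n).toFinset.card : ℝ) with hf
  have hO : (fun n : ℕ => ∑ k ∈ Finset.Icc 1 n, f k) =O[atTop] fun n => (n : ℝ) ^ (1 : ℝ) := by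
    have h1 := ((NumberField.Ideal.tendsto_norm_le_div_atTop₀ K).comp
      tendsto_natCast_atTop_atTop).isBigO_one ℝ
    have h2 : (fun n : ℕ => (Nat.card {I : nonZeroDivisors (Ideal (𝓞 K)) //
        (Ideal.absNorm (I : Ideal (𝓞 K)) : ℝ) ≤ n} : ℝ)) =O[atTop] fun n : ℕ => (n : ℝ) ^ (1 : ℝ) := by
      refine (h1.mul (isBigO_refl (fun n : ℕ => (n : ℝ)) atTop)).congr' ?_ ?_
      · filter_upwards [eventually_gt_atTop 0] with n hn
        have : (n : ℝ) ≠ 0 := by positivity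
        simp only [Function.comp]
        field_simp
      · exact Eventually.of_forall fun n => by simp
    refine IsBigO.trans (IsBigO.of_bound 1 (Eventually.of_forall fun n => ?_)) h2
    rw [one_mul, Real.norm_of_nonneg (Finset.sum_nonneg fun _ _ => Nat.cast_nonneg _),
      Real.norm_of_nonneg (Nat.cast_nonneg _), ← Nat.cast_sum, Nat.cast_le]
    have hmaps : ∀ p ∈ (finite_Nm_le (K := K) n).toFinset, Nm p ∈ Finset.Icc 1 n := fun p hp => by
      rw [Set.Finite.mem_toFinset] at hp
      exact Finset.mem_Icc.2 ⟨Nm_pos p, by exact_mod_cast hp⟩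
    have hcard : ∑ k ∈ Finset.Icc 1 n, (hfin k).toFinset.card =
        (finite_Nm_le (K := K) n).toFinset.card := by
      rw [Finset.card_eq_sum_card_fiberwise hmaps]
      refine Finset.sum_congr rfl fun k hk => congrArg _ ?_
      ext p
      simp only [Set.Finite.mem_toFinset, mem_ofPred_eq, Finset.mem_filter, Nat.cast_le]
      exact ⟨fun h => ⟨h ▸ (Finset.mem_Icc.1 hk).2, h⟩, fun h => h.2⟩
    rw [hcard, ← Nat.card_eq_card_finite_toFinset]
    have hfin2 : Finite {I : nonZeroDivisors (Ideal (𝓞 K)) //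
        (Ideal.absNorm (I : Ideal (𝓞 K)) : ℝ) ≤ n} := by
      have := (Ideal.finite_setOfPred_absNorm_le (S := 𝓞 K) n).to_subtype
      refine Finite.of_injective (β := {I : Ideal (𝓞 K) | Ideal.absNorm I ≤ n})
        (fun I => ⟨I.1.1, by exact_mod_cast I.2⟩) fun I J h => ?_
      exact Subtype.ext (Subtype.ext (Subtype.mk.inj h))
    refine Nat.card_le_card_of_injective (fun p : {p : Pr K | (Nm p : ℝ) ≤ n} =>
      (⟨⟨p.1.asIdeal, mem_nonZeroDivisors_iff_ne_zero.2 p.1.ne_bot⟩, p.2⟩ :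
        {I : nonZeroDivisors (Ideal (𝓞 K)) // (Ideal.absNorm (I : Ideal (𝓞 K)) : ℝ) ≤ n}))
      fun p q h => ?_
    exact Subtype.ext (IsDedekindDomain.HeightOneSpectrum.ext
      (congrArg (fun I => (I.1 : Ideal (𝓞 K))) h))
  have hs := LSeriesSummable_of_sum_norm_bigO_and_nonneg hO (fun n => Nat.cast_nonneg _)
    zero_le_one (s := (σ : ℂ)) (by simpa using hσ)
  -- The terms may differ at `n = 0`, where `LSeries.term` is zero by convention.
  have hs2 : Summable fun n : ℕ => f n * (n : ℝ) ^ (-σ) := by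
    refine hs.norm.congr_cofinite ?_
    refine (Set.finite_singleton 0).subset ?_
    intro n hn
    by_contra h0
    apply hn
    show ‖LSeries.term (fun n => ((f n : ℝ) : ℂ)) σ n‖ = f n * (n : ℝ) ^ (-σ)
    rw [LSeries.norm_term_eq, if_neg (show n ≠ 0 from h0), Complex.ofReal_re, Complex.norm_real,
      Real.norm_of_nonneg (Nat.cast_nonneg _), Real.rpow_neg (Nat.cast_nonneg _), div_eq_mul_inv]
  refine summable_of_sum_le (fun p => Real.rpow_nonneg (Nat.cast_nonneg _) _)
    (c := ∑' n, f n * (n : ℝ) ^ (-σ)) fun u => ?_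
  rw [← Finset.sum_fiberwise_of_maps_to (t := u.image Nm) (g := Nm)
    fun p hp => Finset.mem_image_of_mem _ hp]
  refine le_trans (Finset.sum_le_sum fun n _ => ?_) (hs2.sum_le_tsum (u.image Nm) fun n _ =>
    mul_nonneg (Nat.cast_nonneg _) (Real.rpow_nonneg (Nat.cast_nonneg _) _))
  rw [Finset.sum_congr rfl (g := fun _ => (n : ℝ) ^ (-σ)) fun p hp => by
    rw [(Finset.mem_filter.1 hp).2], Finset.sum_const, nsmul_eq_mul]
  refine mul_le_mul_of_nonneg_right ?_ (Real.rpow_nonneg (Nat.cast_nonneg _) _)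
  rw [hf, Nat.cast_le]
  refine Finset.card_le_card fun p hp => ?_
  simpa using (Finset.mem_filter.1 hp).2

end
end MultiTauberian

/-! ### Mean values of one-variable Euler products. -/

namespace MultiTauberian
noncomputable section
open Set Topology

variable {K : Type*} [Field K] [NumberField K]

/-- The product of the norms of a finite set of primes. -/
def normProd (s : Finset (Pr K)) : ℝ := ∏ p ∈ s, (Nm p : ℝ)

theorem one_le_Nm (p : Pr K) : (1 : ℝ) ≤ Nm p := by exact_mod_cast Nm_pos p

theorem one_le_normProd (s : Finset (Pr K)) : 1 ≤ normProd s :=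
  Finset.prod_induction _ (fun x : ℝ => 1 ≤ x) (fun _ _ => one_le_mul_of_one_le_of_one_le) le_rfl
    fun p _ => one_le_Nm p

theorem prod_Nm_cpow (s : Finset (Pr K)) (z : ℂ) :
    ∏ p ∈ s, (Nm p : ℂ) ^ z = (normProd s : ℂ) ^ z := by
  classical
  induction s using Finset.induction_on with
  | empty => simp [normProd]
  | insert p s hp ih =>
    rw [Finset.prod_insert hp, ih, normProd, normProd, Finset.prod_insert hp, Complex.ofReal_mul,
      Complex.mul_cpow_ofReal_nonneg (Nat.cast_nonneg _)
        (Finset.prod_nonneg fun _ _ => Nat.cast_nonneg _)]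
    simp

theorem prod_Nm_rpow (s : Finset (Pr K)) (σ : ℝ) :
    ∏ p ∈ s, (Nm p : ℝ) ^ σ = normProd s ^ σ :=
  Real.finsetProd_rpow _ _ (fun _ _ => Nat.cast_nonneg _) _

theorem summable_mul_Nm_rpow {γ : Pr K → ℝ} (h0 : ∀ p, 0 ≤ γ p) {B : ℝ} (hB : ∀ p, γ p ≤ B) {σ : ℝ}
    (hσ : 1 < σ) : Summable fun p => γ p * (Nm p : ℝ) ^ (-σ) :=
  ((summable_Nm_rpow hσ).mul_left B).of_nonneg_of_le
    (fun p => mul_nonneg (h0 p) (Real.rpow_nonneg (Nat.cast_nonneg _) _))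
    fun p => mul_le_mul_of_nonneg_right (hB p) (Real.rpow_nonneg (Nat.cast_nonneg _) _)

theorem norm_mul_Nm_cpow (z : ℂ) (p : Pr K) (s : ℂ) :
    ‖z * (Nm p : ℂ) ^ (-s)‖ = ‖z‖ * (Nm p : ℝ) ^ (-s.re) := by
  rw [norm_mul, Complex.norm_natCast_cpow_of_pos (Nm_pos p), Complex.neg_re]

theorem summable_norm_mul_Nm_cpow {γ : Pr K → ℂ} {B : ℝ} (hB : ∀ p, ‖γ p‖ ≤ B) {s : ℂ}
    (hs : 1 < s.re) : Summable fun p => ‖γ p * (Nm p : ℂ) ^ (-s)‖ := by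
  simp_rw [norm_mul_Nm_cpow]
  exact summable_mul_Nm_rpow (fun p => norm_nonneg _) hB hs

/-- The Dirichlet series is indexed by finite sets of primes, so sets with equal norm need not be
collected into one coefficient. -/
theorem tprod_localFactorOne {γ : Pr K → ℂ} {B : ℝ} (hB : ∀ p, ‖γ p‖ ≤ B) {s : ℂ}
    (hs : 1 < s.re) : ∏' p, localFactorOne γ p s =
      ∑' t : Finset (Pr K), (∏ p ∈ t, γ p) * (normProd t : ℂ) ^ (-s) := by
  have h := tprod_one_add (summable_finsetProd_of_summable_norm (summable_norm_mul_Nm_cpow hB hs))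
  simp only [localFactorOne]
  rw [h]
  refine tsum_congr fun t => ?_
  rw [Finset.prod_mul_distrib, prod_Nm_cpow]

theorem ContinuesToLine.congr {f f' : ℂ → ℂ} {r : ℂ} (h : ContinuesToLine f r)
    (hf : ∀ s : ℂ, 1 < s.re → f s = f' s) : ContinuesToLine f' r := by
  obtain ⟨g, hg, hr⟩ := h
  refine ⟨g, fun s hs => ⟨(hg s hs).1, ?_⟩, hr⟩
  filter_upwards [(hg s hs).2] with z hz hz1
  rw [hz hz1, hf z hz1]

/-- The mean value of the coefficients of an Euler product with factors `1 + γ_p N(p)^{-s}`. -/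
theorem tendsto_sumLe_prod {γ : Pr K → ℂ} {γ' : Pr K → ℝ} {B : ℝ} (hB : ∀ p, γ' p ≤ B)
    (hγ : ∀ p, ‖γ p‖ ≤ γ' p) {r r' : ℂ}
    (h : ContinuesToLine (fun s => ∏' p, localFactorOne γ p s) r)
    (h' : ContinuesToLine (fun s => ∏' p, localFactorOne (fun p => (γ' p : ℂ)) p s) r') :
    Tendsto (fun x => sumLe (fun t => ∏ p ∈ t, γ p) normProd x / x) atTop (𝓝 r) ∧
      ∃ M, ∀ x, ‖sumLe (fun t => ∏ p ∈ t, γ p) normProd x‖ ≤ M * |x| := by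
  have h0 : ∀ p, 0 ≤ γ' p := fun p => (norm_nonneg _).trans (hγ p)
  refine wienerIkehara (a' := fun t => ∏ p ∈ t, γ' p) (r' := r') (fun t => ?_) one_le_normProd
    (fun σ hσ => ?_) ?_ ?_
  · rw [norm_prod]
    exact Finset.prod_le_prod (fun _ _ => norm_nonneg _) fun p _ => hγ p
  · refine (summable_finsetProd_of_summable_nonneg (fun p => ?_)
      (summable_mul_Nm_rpow h0 hB hσ)).congr fun t => ?_
    · exact mul_nonneg (h0 p) (Real.rpow_nonneg (Nat.cast_nonneg _) _)
    · rw [Finset.prod_mul_distrib, prod_Nm_rpow]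
  · exact h.congr fun s hs => tprod_localFactorOne (fun p => (hγ p).trans (hB p)) hs
  · refine h'.congr fun s hs => ?_
    rw [tprod_localFactorOne (B := B) (fun p => by
      rw [Complex.norm_real, Real.norm_of_nonneg (h0 p)]
      exact hB p) hs]
    simp

/-- `γ` restricted to the primes of norm greater than `E`. -/
def cutoff {R : Type*} [Zero R] (E : ℝ) (γ : Pr K → R) : Pr K → R :=
  {p : Pr K | E < (Nm p : ℝ)}.indicator γ

theorem tailProduct_eq (E : ℝ) (γ : Pr K → ℂ) (s : ℂ) :
    tailProduct E γ s = ∏' p, localFactorOne (cutoff E γ) p s := by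
  rw [tailProduct]
  refine (tprod_subtype {p : Pr K | E < (Nm p : ℝ)} fun p => localFactorOne γ p s).trans ?_
  refine tprod_congr fun p => ?_
  by_cases hp : E < (Nm p : ℝ)
  · simp [mulIndicator, cutoff, hp, localFactorOne]
  · simp [mulIndicator, cutoff, hp, localFactorOne]

/-- The primes with norm in `(E₀, E₁]`. -/
def primesBetween (E₀ E₁ : ℝ) : Finset (Pr K) :=
  ((finite_Nm_le E₁).subset (fun _ h => h.2 : {p : Pr K | E₀ < Nm p ∧ (Nm p : ℝ) ≤ E₁} ⊆ _)).toFinset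

theorem mem_primesBetween {E₀ E₁ : ℝ} {p : Pr K} :
    p ∈ primesBetween E₀ E₁ ↔ E₀ < Nm p ∧ (Nm p : ℝ) ≤ E₁ := by
  simp [primesBetween]

theorem norm_cutoff_le {E B : ℝ} {γ : Pr K → ℂ} (hB : ∀ p, ‖γ p‖ ≤ B) (p : Pr K) :
    ‖cutoff E γ p‖ ≤ B := (norm_indicator_le_norm_self _ _).trans (hB p)

theorem tailProduct_eq_mul {E₀ E₁ : ℝ} (hE : E₀ ≤ E₁) {γ : Pr K → ℂ} {B : ℝ}
    (hB : ∀ p, ‖γ p‖ ≤ B) {s : ℂ} (hs : 1 < s.re) :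
    tailProduct E₀ γ s = (∏ p ∈ primesBetween E₀ E₁, localFactorOne γ p s) *
      ∏' p, localFactorOne (cutoff E₁ γ) p s := by
  classical
  have h1 : HasProd (fun p => if p ∈ primesBetween E₀ E₁ then localFactorOne γ p s else 1)
      (∏ p ∈ primesBetween E₀ E₁, localFactorOne γ p s) := by
    have := hasProd_prod_of_ne_finset_one (s := primesBetween E₀ E₁)
      (f := fun p => if p ∈ primesBetween E₀ E₁ then localFactorOne γ p s else 1)
      (L := SummationFilter.unconditional _) fun p hp => if_neg hp
    rwa [Finset.prod_congr rfl fun p hp => if_pos hp] at this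
  have h2 : Multipliable fun p => localFactorOne (cutoff E₁ γ) p s :=
    multipliable_one_add_of_summable (summable_norm_mul_Nm_cpow (norm_cutoff_le hB) hs)
  rw [tailProduct_eq, ← (h1.mul h2.hasProd).tprod_eq]
  refine tprod_congr fun p => ?_
  by_cases hp1 : E₁ < (Nm p : ℝ)
  · have hp0 := hE.trans_lt hp1
    simp [cutoff, localFactorOne, mem_primesBetween, indicator, hp0, hp1]
  · by_cases hp0 : E₀ < (Nm p : ℝ)
    · simp [cutoff, localFactorOne, mem_primesBetween, indicator, hp0, hp1, not_lt.1 hp1]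
    · simp [cutoff, localFactorOne, mem_primesBetween, indicator, hp0, hp1]

theorem analyticAt_localFactorOne (γ : Pr K → ℂ) (p : Pr K) (s : ℂ) :
    AnalyticAt ℂ (localFactorOne γ p) s := by
  have hN : (Nm p : ℂ) ≠ 0 := by exact_mod_cast (Nm_pos p).ne'
  have : Differentiable ℂ (localFactorOne γ p) := by
    intro z
    unfold localFactorOne
    exact (differentiableAt_const _).add
      ((differentiableAt_const _).mul (differentiableAt_id.neg.const_cpow (Or.inl hN)))
  exact this.analyticAt s

/-- The finitely many removed factors have no zeros on `Re s = 1`, hence none near each of its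
points, and can be divided out locally. This is why `ContinuesToLine` asks only for local agreement.
-/
theorem continuesToLine_of_tailProduct {E₀ E₁ : ℝ} (hE : E₀ ≤ E₁) {γ : Pr K → ℂ} {B : ℝ}
    (hB : ∀ p, ‖γ p‖ ≤ B)
    (hne : ∀ p ∈ primesBetween (K := K) E₀ E₁, ∀ s : ℂ, s.re = 1 → localFactorOne γ p s ≠ 0) {r : ℂ}
    (h : ContinuesWithValue (fun s => (s - 1) * tailProduct E₀ γ s) r) :
    ContinuesToLine (fun s => ∏' p, localFactorOne (cutoff E₁ γ) p s)
      (r / ∏ p ∈ primesBetween E₀ E₁, localFactorOne γ p 1) := by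
  obtain ⟨g, hg, hgf, hg1⟩ := h
  set P : ℂ → ℂ := fun s => ∏ p ∈ primesBetween E₀ E₁, localFactorOne γ p s with hP
  have hPan : ∀ s, AnalyticAt ℂ P s := fun s =>
    Finset.analyticAt_fun_prod _ fun p _ => analyticAt_localFactorOne γ p s
  have hPne : ∀ s : ℂ, s.re = 1 → P s ≠ 0 := fun s hs =>
    Finset.prod_ne_zero_iff.2 fun p hp => hne p hp s hs
  refine ⟨fun s => g s / P s, fun s hs => ⟨(hg s hs.ge).fun_div (hPan s) (hPne s hs), ?_⟩, ?_⟩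
  · filter_upwards [(hPan s).continuousAt.eventually_ne (hPne s hs)] with z hz hz1
    rw [div_eq_iff hz, hgf z hz1]
    simp only
    rw [tailProduct_eq_mul hE hB hz1]
    ring
  · simp only [hg1, hP]

end
end MultiTauberian

/-! ### The Banach algebra of shifts. -/

namespace MultiTauberian
noncomputable section
open Set Topology BoundedContinuousFunction

/-- A copy of `Fin m → ℝ` with the discrete topology. -/
structure Dom (m : ℕ) where
  /-- The coordinates of a point. -/
  coord : Fin m → ℝ

variable {m : ℕ}

instance : TopologicalSpace (Dom m) := ⊥
instance : DiscreteTopology (Dom m) := ⟨rfl⟩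

theorem norm_prod_inv_smul_le (y : Fin m → ℕ) (Φ : Dom m →ᵇ ℂ) (h : C(Dom m, Dom m)) :
    ‖(∏ i, (y i : ℂ))⁻¹ • Φ.compContinuous h‖ ≤ (∏ i, (y i : ℝ))⁻¹ * ‖Φ‖ := by
  refine (norm_smul_le _ _).trans ?_
  have h1 : ‖(∏ i, (y i : ℂ))⁻¹‖ = (∏ i, (y i : ℝ))⁻¹ := by
    rw [norm_inv, norm_prod]
    simp
  rw [h1]
  refine mul_le_mul_of_nonneg_left ?_ (by positivity)
  exact (BoundedContinuousFunction.norm_le (norm_nonneg _)).2 fun X => Φ.norm_coe_le_norm _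

/-- The map `Φ ↦ (∏ y)⁻¹ Φ(X / y)` on bounded functions. -/
def shift (y : Fin m → ℕ) : (Dom m →ᵇ ℂ) →L[ℂ] (Dom m →ᵇ ℂ) :=
  LinearMap.mkContinuous
    { toFun := fun Φ => (∏ i, (y i : ℂ))⁻¹ •
        Φ.compContinuous ⟨fun X => ⟨fun i => X.coord i / y i⟩, continuous_of_discreteTopology⟩
      map_add' := fun Φ Ψ => by ext X; simp [mul_add]
      map_smul' := fun a Φ => by ext X; simp; ring }
    (∏ i, (y i : ℝ))⁻¹ fun Φ => norm_prod_inv_smul_le y Φ _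

theorem shift_apply (y : Fin m → ℕ) (Φ : Dom m →ᵇ ℂ) (X : Dom m) :
    shift y Φ X = (∏ i, (y i : ℂ))⁻¹ * Φ ⟨fun i => X.coord i / y i⟩ := rfl

theorem norm_shift_le (y : Fin m → ℕ) : ‖shift y‖ ≤ (∏ i, (y i : ℝ))⁻¹ :=
  LinearMap.mkContinuous_norm_le _ (by positivity) _

variable (m) in
/-- The shifts, together with the factors by which they act on limits at infinity. -/
def shiftPair : (Fin m → ℕ) →* ((Dom m →ᵇ ℂ) →L[ℂ] (Dom m →ᵇ ℂ)) × ℂ where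
  toFun y := (shift y, (∏ i, (y i : ℂ))⁻¹)
  map_one' := by
    ext X <;> simp [shift_apply]
  map_mul' y y' := by
    ext Φ X
    · simp only [shift_apply, Prod.fst_mul, mul_apply_eq_comp, Pi.mul_apply,
        Nat.cast_mul, Finset.prod_mul_distrib, mul_inv, div_div]
      ring
    · simp [Finset.prod_mul_distrib, mul_comm]

/-- The bounded functions that tend to zero. -/
theorem isClosed_tendsto_zero :
    IsClosed {Φ : Dom m →ᵇ ℂ | Tendsto (fun X : Fin m → ℝ => Φ ⟨X⟩) atTop (𝓝 0)} := by
  refine isClosed_of_closure_subset fun Φ hΦ => ?_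
  refine Metric.tendsto_nhds.2 fun ε hε => ?_
  obtain ⟨Ψ, hΨ, hd⟩ := Metric.mem_closure_iff.1 hΦ (ε / 2) (half_pos hε)
  filter_upwards [Metric.tendsto_nhds.1 hΨ (ε / 2) (half_pos hε)] with X hX
  calc dist (Φ ⟨X⟩) 0 ≤ dist (Φ ⟨X⟩) (Ψ ⟨X⟩) + dist (Ψ ⟨X⟩) 0 := dist_triangle _ _ _
    _ < ε / 2 + ε / 2 := add_lt_add ((BoundedContinuousFunction.dist_coe_le_dist _).trans_lt hd) hX
    _ = ε := add_halves ε

/-- The pairs `(a, z)` such that `a` multiplies limits at infinity by `z`, and `a Φ` vanishes on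
each box on which `Φ` vanishes. -/
def causalSubalgebra (m : ℕ) : Subalgebra ℂ (((Dom m →ᵇ ℂ) →L[ℂ] (Dom m →ᵇ ℂ)) × ℂ) where
  carrier := {a | (∀ (Φ : Dom m →ᵇ ℂ) (z : ℂ), Tendsto (fun X : Fin m → ℝ => Φ ⟨X⟩) atTop (𝓝 z) →
      Tendsto (fun X : Fin m → ℝ => a.1 Φ ⟨X⟩) atTop (𝓝 (a.2 * z))) ∧
    ∀ (Z : ℝ), 0 ≤ Z → ∀ Φ : Dom m →ᵇ ℂ, (∀ X : Dom m, (∀ i, X.coord i ≤ Z) → Φ X = 0) →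
      ∀ X : Dom m, (∀ i, X.coord i ≤ Z) → a.1 Φ X = 0}
  mul_mem' {a b} ha hb := by
    refine ⟨fun Φ z h => ?_, fun Z hZ Φ h => ?_⟩
    · rw [Prod.snd_mul, mul_assoc]
      exact ha.1 _ _ (hb.1 _ _ h)
    · exact ha.2 Z hZ _ (hb.2 Z hZ _ h)
  add_mem' {a b} ha hb := by
    refine ⟨fun Φ z h => ?_, fun Z hZ Φ h X hX => ?_⟩
    · rw [Prod.snd_add, add_mul]
      exact (ha.1 _ _ h).add (hb.1 _ _ h)
    · have h1 := ha.2 Z hZ _ h X hX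
      have h2 := hb.2 Z hZ _ h X hX
      simp [h1, h2]
  algebraMap_mem' c := by
    refine ⟨fun Φ z h => ?_, fun Z hZ Φ h X hX => ?_⟩
    · exact h.const_mul c
    · simp [Algebra.algebraMap_eq_smul_one, h X hX]

/-- Each defining condition concerns a fixed `Φ` and is a closed condition on its image. Closedness
carries the properties from the shifts to norm limits of their combinations, hence to infinite
products. -/
theorem isClosed_causalSubalgebra :
    IsClosed (causalSubalgebra m : Set (((Dom m →ᵇ ℂ) →L[ℂ] (Dom m →ᵇ ℂ)) × ℂ)) := by
  have h1 : (causalSubalgebra m : Set (((Dom m →ᵇ ℂ) →L[ℂ] (Dom m →ᵇ ℂ)) × ℂ)) =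
      (⋂ (Φ : Dom m →ᵇ ℂ) (z : ℂ) (_ : Tendsto (fun X : Fin m → ℝ => Φ ⟨X⟩) atTop (𝓝 z)),
        {a | a.1 Φ - BoundedContinuousFunction.const (Dom m) (a.2 * z) ∈
          {Φ : Dom m →ᵇ ℂ | Tendsto (fun X : Fin m → ℝ => Φ ⟨X⟩) atTop (𝓝 0)}}) ∩
      ⋂ (Z : ℝ) (_ : 0 ≤ Z) (Φ : Dom m →ᵇ ℂ) (_ : ∀ X : Dom m, (∀ i, X.coord i ≤ Z) → Φ X = 0)
        (X : Dom m) (_ : ∀ i, X.coord i ≤ Z), {a | a.1 Φ X = 0} := by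
    ext a
    simp only [mem_inter_iff, mem_iInter, mem_ofPred_eq, BoundedContinuousFunction.coe_sub,
      Pi.sub_apply, BoundedContinuousFunction.const_apply, tendsto_sub_nhds_zero_iff]
    rfl
  rw [h1]
  refine IsClosed.inter ?_ ?_
  · refine isClosed_iInter fun Φ => isClosed_iInter fun z => isClosed_iInter fun _ => ?_
    refine isClosed_tendsto_zero.preimage (Continuous.sub ?_ ?_)
    · exact ((ContinuousLinearMap.apply ℂ _ Φ).continuous).comp continuous_fst
    · refine Continuous.comp (g := fun z : ℂ => BoundedContinuousFunction.const (Dom m) z) ?_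
        (continuous_snd.mul_const z)
      exact (LipschitzWith.of_dist_le_mul (K := 1) fun x y => by
        rw [NNReal.coe_one, one_mul]
        exact (BoundedContinuousFunction.dist_le dist_nonneg).2 fun _ => le_rfl).continuous
  · refine isClosed_iInter fun Z => isClosed_iInter fun _ => isClosed_iInter fun Φ =>
      isClosed_iInter fun _ => isClosed_iInter fun X => isClosed_iInter fun _ => ?_
    refine isClosed_singleton.preimage (f := fun a : ((Dom m →ᵇ ℂ) →L[ℂ] (Dom m →ᵇ ℂ)) × ℂ =>
      a.1 Φ X) ?_
    exact (BoundedContinuousFunction.lipschitz_eval_const X).continuous.comp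
      (((ContinuousLinearMap.apply ℂ _ Φ).continuous).comp continuous_fst)

theorem shiftPair_mem (y : Fin m → ℕ) : shiftPair m y ∈ causalSubalgebra m := by
  by_cases hy : ∀ i, 0 < y i
  · refine ⟨fun Φ z h => ?_, fun Z hZ Φ h X hX => ?_⟩
    · have h1 : Tendsto (fun X : Fin m → ℝ => fun i => X i / (y i : ℝ)) atTop atTop := by
        refine tendsto_atTop.2 fun A => ?_
        filter_upwards [eventually_ge_atTop fun i => A i * y i] with X hX i
        rw [le_div_iff₀ (Nat.cast_pos.2 (hy i))]
        exact hX i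
      exact (h.comp h1).const_mul _
    · have : Φ ⟨fun i => X.coord i / y i⟩ = 0 := h _ fun i => by
        have h1 : (1 : ℝ) ≤ y i := by exact_mod_cast hy i
        rw [div_le_iff₀ (by linarith)]
        nlinarith [hX i]
      show shift y Φ X = 0
      rw [shift_apply, this, mul_zero]
  -- If some `y i` is zero, the convention `0⁻¹ = 0` makes the whole pair vanish.
  · obtain ⟨i, hi⟩ := not_forall.1 hy
    have h0 : ∏ i, (y i : ℂ) = 0 :=
      Finset.prod_eq_zero (Finset.mem_univ i) (by simpa using hi)
    have h1 : shiftPair m y = 0 := by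
      refine Prod.ext (ContinuousLinearMap.ext fun Φ => BoundedContinuousFunction.ext fun X => ?_) ?_
      · show shift y Φ X = 0
        rw [shift_apply, h0, inv_zero, zero_mul]
      · show (∏ i, (y i : ℂ))⁻¹ = 0
        rw [h0, inv_zero]
    rw [h1]
    exact zero_mem _

/-- The closure of a commutative subalgebra of a normed algebra, as a normed commutative ring. -/
@[reducible] def normedCommRingClosure {A : Type*} [NormedRing A] [NormedAlgebra ℂ A]
    (S : Subalgebra ℂ A) (hS : ∀ x y : S, x * y = y * x) : NormedCommRing S.topologicalClosure :=
  { (inferInstance : NormedRing S.topologicalClosure) with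
    mul_comm := (Subalgebra.commRingTopologicalClosure S hS).mul_comm }

instance : Nontrivial (Dom m →ᵇ ℂ) :=
  ⟨BoundedContinuousFunction.const _ 0, BoundedContinuousFunction.const _ 1, fun h => by
    simpa using congrArg (fun f : Dom m →ᵇ ℂ => f ⟨fun _ => 0⟩) h⟩

instance : NormOneClass (((Dom m →ᵇ ℂ) →L[ℂ] (Dom m →ᵇ ℂ)) × ℂ) :=
  ⟨by rw [Prod.norm_def, Prod.fst_one, Prod.snd_one, norm_one, norm_one, max_self]⟩

/-- A representation of a commutative Banach algebra on bounded functions, in which the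
elements `t y` act as shifts. -/
structure ShiftRep (m : ℕ) (B : Type*) [NormedCommRing B] [NormedAlgebra ℂ B] where
  /-- The element acting as the shift by `y`. -/
  t : (Fin m → ℕ) →* B
  /-- The action on bounded functions. -/
  act : B →ₐ[ℂ] ((Dom m →ᵇ ℂ) →L[ℂ] (Dom m →ᵇ ℂ))
  /-- The action on limits at infinity. -/
  chi : B →ₐ[ℂ] ℂ
  continuous_act : Continuous act
  continuous_chi : Continuous chi
  norm_t_le : ∀ y, ‖t y‖ ≤ (∏ i, (y i : ℝ))⁻¹
  chi_t : ∀ y, chi (t y) = (∏ i, (y i : ℂ))⁻¹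
  act_t : ∀ y Φ X, act (t y) Φ X = (∏ i, (y i : ℂ))⁻¹ * Φ ⟨fun i => X.coord i / y i⟩
  tendsto_act : ∀ (a : B) (Φ : Dom m →ᵇ ℂ) (z : ℂ),
    Tendsto (fun X : Fin m → ℝ => Φ ⟨X⟩) atTop (𝓝 z) →
      Tendsto (fun X : Fin m → ℝ => act a Φ ⟨X⟩) atTop (𝓝 (chi a * z))
  act_eq_zero : ∀ (a : B) (Z : ℝ), 0 ≤ Z → ∀ Φ : Dom m →ᵇ ℂ,
    (∀ X : Dom m, (∀ i, X.coord i ≤ Z) → Φ X = 0) →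
      ∀ X : Dom m, (∀ i, X.coord i ≤ Z) → act a Φ X = 0

/-- `B` is the closure of the algebra generated by the shifts: commutative because they commute,
complete because it is closed, and mapped into `causalSubalgebra` because that is closed. -/
theorem exists_shiftRep_of_algHom {A : Type} [NormedRing A] [NormedAlgebra ℂ A] [CompleteSpace A]
    [NormOneClass A]
    (f : A →ₐ[ℂ] ((Dom m →ᵇ ℂ) →L[ℂ] (Dom m →ᵇ ℂ))) (g : A →ₐ[ℂ] ℂ) (hf : Continuous f)
    (hg : Continuous g) (t : (Fin m → ℕ) →* A)
    (ht : ∀ y, ‖t y‖ ≤ (∏ i, (y i : ℝ))⁻¹) (hgt : ∀ y, g (t y) = (∏ i, (y i : ℂ))⁻¹)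
    (hft : ∀ y, f (t y) = shift y) :
    ∃ (B : Type) (_ : NormedCommRing B) (_ : NormedAlgebra ℂ B) (_ : CompleteSpace B)
      (_ : NormOneClass B), Nonempty (ShiftRep m B) := by
  set S := Algebra.adjoin ℂ (Set.range t) with hSdef
  have hS : ∀ x y : S, x * y = y * x := by
    have := Algebra.isMulCommutative_adjoin ℂ (s := Set.range t) (by
      rintro _ ⟨y, rfl⟩ _ ⟨z, rfl⟩
      rw [← map_mul, mul_comm, map_mul])
    exact fun a b => mul_comm' a b
  have hcl : S.topologicalClosure ≤ (causalSubalgebra m).comap (f.prod g) := by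
    refine Subalgebra.topologicalClosure_minimal (Algebra.adjoin_le ?_)
      (isClosed_causalSubalgebra.preimage (hf.prodMk hg))
    rintro _ ⟨y, rfl⟩
    have h1 : (f (t y), g (t y)) = shiftPair m y := Prod.ext (hft y) (hgt y)
    show (f (t y), g (t y)) ∈ causalSubalgebra m
    rw [h1]
    exact shiftPair_mem y
  let _ := normedCommRingClosure S hS
  let _ : NormedAlgebra ℂ S.topologicalClosure := Subalgebra.toNormedAlgebra _
  refine ⟨S.topologicalClosure, inferInstance, inferInstance,
    S.isClosed_topologicalClosure.completeSpace_coe, ⟨(norm_one : ‖(1 : A)‖ = 1)⟩, ⟨{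
      t :=
        { toFun := fun y => ⟨t y, S.le_topologicalClosure (Algebra.subset_adjoin ⟨y, rfl⟩)⟩
          map_one' := Subtype.ext (map_one t)
          map_mul' := fun x y => Subtype.ext (map_mul t x y) }
      act := f.comp S.topologicalClosure.val
      chi := g.comp S.topologicalClosure.val
      continuous_act := hf.comp continuous_subtype_val
      continuous_chi := hg.comp continuous_subtype_val
      norm_t_le := ht
      chi_t := hgt
      act_t := fun y Φ X => ?_
      tendsto_act := fun a => (hcl a.2).1
      act_eq_zero := fun a => (hcl a.2).2 }⟩⟩
  show f (t y) Φ X = _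
  rw [hft y, shift_apply]

theorem exists_shiftRep (m : ℕ) :
    ∃ (B : Type) (_ : NormedCommRing B) (_ : NormedAlgebra ℂ B) (_ : CompleteSpace B)
      (_ : NormOneClass B), Nonempty (ShiftRep m B) := by
  refine exists_shiftRep_of_algHom (A := ((Dom m →ᵇ ℂ) →L[ℂ] (Dom m →ᵇ ℂ)) × ℂ)
    (AlgHom.fst ℂ _ _) (AlgHom.snd ℂ _ _) continuous_fst continuous_snd
    (shiftPair m) (fun y => ?_) (fun y => rfl) fun y => rfl
  rw [Prod.norm_def]
  refine max_le (norm_shift_le y) (le_of_eq ?_)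
  show ‖(∏ i, (y i : ℂ))⁻¹‖ = _
  rw [norm_inv, norm_prod]
  simp

end
end MultiTauberian

/-! ### Local factors as elements of the algebra. -/

namespace MultiTauberian
noncomputable section
open Set Topology BoundedContinuousFunction

variable {K : Type*} [Field K] [NumberField K] {m : ℕ}

section Banach

variable {B : Type*} [NormedCommRing B]

/-- Only monomials of degree at least two remain, each of norm at most `ε ^ 2`; the constant `4 ^
s.card` is generous, to close the induction easily. -/
theorem norm_prod_one_add_sub_le {ι : Type*} (s : Finset ι) (x : ι → B) {ε : ℝ}
    (hε0 : 0 ≤ ε) (hε1 : ε ≤ 1) (hx : ∀ i ∈ s, ‖x i‖ ≤ ε) :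
    ‖∏ i ∈ s, (1 + x i) - 1 - ∑ i ∈ s, x i‖ ≤ 4 ^ s.card * ε ^ 2 := by
  classical
  induction s using Finset.induction_on with
  | empty => simp; positivity
  | insert j s hj ih =>
    have ih' := ih fun i hi => hx i (Finset.mem_insert_of_mem hi)
    have hxj := hx j (Finset.mem_insert_self _ _)
    rw [Finset.prod_insert hj, Finset.sum_insert hj, Finset.card_insert_of_notMem hj]
    have h1 : (1 + x j) * ∏ i ∈ s, (1 + x i) - 1 - (x j + ∑ i ∈ s, x i) =
        (∏ i ∈ s, (1 + x i) - 1 - ∑ i ∈ s, x i) +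
          x j * (∏ i ∈ s, (1 + x i) - 1 - ∑ i ∈ s, x i) + x j * ∑ i ∈ s, x i := by ring
    rw [h1]
    set A := ∏ i ∈ s, (1 + x i) - 1 - ∑ i ∈ s, x i
    have h2 : ‖x j * A‖ ≤ 1 * ‖A‖ := (norm_mul_le _ _).trans
      (mul_le_mul_of_nonneg_right (hxj.trans hε1) (norm_nonneg _))
    have h3 : ‖x j * ∑ i ∈ s, x i‖ ≤ ε * (s.card * ε) := by
      refine (norm_mul_le _ _).trans (mul_le_mul hxj ?_ (norm_nonneg _) hε0)
      refine (norm_sum_le _ _).trans ((Finset.sum_le_card_nsmul _ _ ε fun i hi =>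
        hx i (Finset.mem_insert_of_mem hi)).trans_eq (nsmul_eq_mul _ _))
    have h4 : ((s.card : ℕ) : ℝ) ≤ 4 ^ s.card := by
      exact_mod_cast (Nat.lt_pow_self (by norm_num : 1 < 4)).le
    have h5 : ε * (s.card * ε) ≤ 4 ^ s.card * ε ^ 2 := by nlinarith [sq_nonneg ε]
    have h6 : 0 ≤ (4 : ℝ) ^ s.card * ε ^ 2 := by positivity
    calc _ ≤ ‖A‖ + ‖x j * A‖ + ‖x j * ∑ i ∈ s, x i‖ := norm_add₃_le
      _ ≤ 4 ^ (s.card + 1) * ε ^ 2 := by rw [pow_succ]; linarith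

theorem exists_inverse_one_add [NormOneClass B] [CompleteSpace B] {x : B} (hx : ‖x‖ ≤ 1 / 2) :
    ∃ u : B, u * (1 + x) = 1 ∧ ‖u‖ ≤ 2 := by
  have hlt : ‖-x‖ < 1 := by rw [norm_neg]; linarith
  refine ⟨∑' n : ℕ, (-x) ^ n, ?_, ?_⟩
  · have := geom_series_mul_neg (-x) hlt
    rwa [sub_neg_eq_add] at this
  · refine (tsum_geometric_le_of_norm_lt_one (-x) hlt).trans ?_
    rw [norm_one, sub_self, zero_add, norm_neg]
    exact inv_le_of_inv_le₀ (by norm_num) (by linarith)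

end Banach

/-- The summatory function of `1`, divided by `∏ X`. -/
def delta (m : ℕ) : Dom m →ᵇ ℂ :=
  open Classical in
  BoundedContinuousFunction.ofNormedAddCommGroupDiscrete
    (fun X => if ∀ i, 1 ≤ X.coord i then (∏ i, (X.coord i : ℂ))⁻¹ else 0) 1 (by
      intro X
      split_ifs with h
      · rw [norm_inv, norm_prod]
        refine inv_le_one_of_one_le₀ ?_
        refine Finset.prod_induction _ (fun x : ℝ => 1 ≤ x)
          (fun _ _ => one_le_mul_of_one_le_of_one_le) le_rfl fun i _ => ?_
        rw [Complex.norm_real]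
        exact (h i).trans (le_abs_self _)
      · simp)

open Classical in
theorem delta_apply (X : Dom m) :
    delta m X = if ∀ i, 1 ≤ X.coord i then (∏ i, (X.coord i : ℂ))⁻¹ else 0 := rfl

namespace ShiftRep

variable {B : Type*} [NormedCommRing B] [NormedAlgebra ℂ B] (ρ : ShiftRep m B)

-- The shift by `y` turns `delta` into the normalized summatory function of the single monomial with
-- index `y`; by linearity, a Dirichlet polynomial acting on `delta` gives its normalized
-- coefficient sum.
open Classical in
theorem act_t_delta (y : Fin m → ℕ) (hy : ∀ i, 0 < y i) (X : Dom m) :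
    ρ.act (ρ.t y) (delta m) X =
      if ∀ i, (y i : ℝ) ≤ X.coord i then (∏ i, (X.coord i : ℂ))⁻¹ else 0 := by
  have hy' : ∀ i, (0 : ℝ) < y i := fun i => Nat.cast_pos.2 (hy i)
  rw [ρ.act_t, delta_apply]
  simp only [one_le_div (hy' _)]
  split_ifs with h
  · rw [← mul_inv, ← Finset.prod_mul_distrib]
    congr 1
    refine Finset.prod_congr rfl fun i _ => ?_
    have : (y i : ℂ) ≠ 0 := by exact_mod_cast (hy i).ne'
    push_cast
    field_simp
  · simp

/-- The element `N(p)^{-s_i}`. -/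
def tp (p : Pr K) (i : Fin m) : B := ρ.t (Pi.mulSingle i (Nm p))

theorem prod_mulSingle {M : Type*} [CommMonoid M] {R : Type*} [CommMonoid R] (f : M → R) (h1 : f 1 = 1)
    (i : Fin m) (n : M) : ∏ j, f (Pi.mulSingle (M := fun _ => M) i n j) = f n := by
  rw [Finset.prod_eq_single i]
  · simp
  · intro j _ hj
    rw [Pi.mulSingle_eq_of_ne hj, h1]
  · simp

theorem norm_tp_le (p : Pr K) (i : Fin m) : ‖ρ.tp p i‖ ≤ (Nm p : ℝ)⁻¹ := by
  have := ρ.norm_t_le (Pi.mulSingle i (Nm p))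
  rwa [prod_mulSingle (fun n : ℕ => (n : ℝ)) (by simp)] at this

theorem chi_tp (p : Pr K) (i : Fin m) : ρ.chi (ρ.tp p i) = (Nm p : ℂ)⁻¹ := by
  have := ρ.chi_t (Pi.mulSingle i (Nm p))
  rwa [prod_mulSingle (fun n : ℕ => (n : ℂ)) (by simp)] at this

/-- The factor `b_p + ∑ c_{p,i} N(p)^{-s_i}`. -/
def factor (b : Pr K → ℂ) (c : Pr K → Fin m → ℂ) (p : Pr K) : B :=
  algebraMap ℂ B (b p) + ∑ i, c p i • ρ.tp p i

/-- The factor `∏ (1 + c_{p,i} N(p)^{-s_i})`. -/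
def factorProd (c : Pr K → Fin m → ℂ) (p : Pr K) : B := ∏ i, (1 + c p i • ρ.tp p i)

theorem chi_factor (b : Pr K → ℂ) (c : Pr K → Fin m → ℂ) (p : Pr K) :
    ρ.chi (ρ.factor b c p) = localFactor b c p fun _ => 1 := by
  rw [factor, localFactor, map_add, AlgHom.commutes, map_sum]
  simp [chi_tp, Complex.cpow_neg_one]

theorem chi_factorProd (c : Pr K → Fin m → ℂ) (p : Pr K) :
    ρ.chi (ρ.factorProd c p) = ∏ i, localFactorOne (fun q => c q i) p 1 := by
  rw [factorProd, map_prod]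
  refine Finset.prod_congr rfl fun i _ => ?_
  simp [chi_tp, Complex.cpow_neg_one, localFactorOne]

/-- The bound on `ct` makes every `1 + ct N(p)^{-s_i}` invertible by a geometric series, with
inverse of norm at most `2`. If `b p = 1` and `c p = ct p`, numerator and denominator share their
terms of degree at most one, so `h - 1` is quadratic in `C / N(p)`. -/
theorem exists_quotient [NormOneClass B] [CompleteSpace B] (b : Pr K → ℂ)
    (c ct : Pr K → Fin m → ℂ) (p : Pr K) (hct : ∀ i, ‖ct p i‖ ≤ Nm p / 2) :
    ∃ h : B, h * ρ.factorProd ct p = ρ.factor b c p ∧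
      (b p = 1 → c p = ct p → ∀ C : ℝ, (∀ i, ‖c p i‖ ≤ C) → C ≤ Nm p →
        ‖h - 1‖ ≤ 2 ^ m * (4 ^ m * (C / Nm p) ^ 2)) := by
  have hN : (0 : ℝ) < Nm p := Nat.cast_pos.2 (Nm_pos p)
  have hx : ∀ (i : Fin m) (C : ℝ) (z : ℂ), ‖z‖ ≤ C → ‖z • ρ.tp p i‖ ≤ C / Nm p := by
    intro i C z hz
    rw [norm_smul, div_eq_mul_inv]
    exact mul_le_mul hz (ρ.norm_tp_le p i) (norm_nonneg _) ((norm_nonneg _).trans hz)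
  have hhalf : ∀ i, ‖ct p i • ρ.tp p i‖ ≤ 1 / 2 := fun i =>
    (hx i _ _ (hct i)).trans_eq (by field_simp)
  choose u hu hu2 using fun i => exists_inverse_one_add (hhalf i)
  have hU : (∏ i, u i) * ρ.factorProd ct p = 1 := by
    rw [factorProd, ← Finset.prod_mul_distrib]
    exact Finset.prod_eq_one fun i _ => hu i
  refine ⟨ρ.factor b c p * ∏ i, u i, by rw [mul_assoc, hU, mul_one], fun hb hc C hC hCN => ?_⟩
  have h1 : ρ.factor b c p * ∏ i, u i - 1 =
      (∏ i, u i) * -(∏ i, (1 + c p i • ρ.tp p i) - 1 - ∑ i, c p i • ρ.tp p i) := by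
    rw [factorProd, ← hc] at hU
    rw [factor, hb, map_one]
    linear_combination hU
  rw [h1]
  refine (norm_mul_le _ _).trans (mul_le_mul ?_ ?_ (norm_nonneg _) (by positivity))
  · refine (Finset.norm_prod_le _ _).trans ?_
    refine (Finset.prod_le_prod (fun _ _ => norm_nonneg _) fun i _ => hu2 i).trans_eq ?_
    simp
  · rw [norm_neg]
    -- For `m = 0` nothing forces `0 ≤ C`, but the remainder is then zero.
    rcases isEmpty_or_nonempty (Fin m) with he | ⟨⟨i⟩⟩
    · simp
      positivity
    have hC0 : 0 ≤ C := (norm_nonneg _).trans (hC i)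
    have := norm_prod_one_add_sub_le Finset.univ (fun i => c p i • ρ.tp p i)
      (ε := C / Nm p) (by positivity) ((div_le_one hN).2 hCN) fun i _ => hx i C _ (hC i)
    simpa using this

theorem prod_factorProd (c : Pr K → Fin m → ℂ) (T : Finset (Pr K)) :
    ∏ p ∈ T, ρ.factorProd c p = ∑ σ ∈ Fintype.piFinset fun _ : Fin m => T.powerset,
      (∏ i, ∏ p ∈ σ i, c p i) • ρ.t fun i => ∏ p ∈ σ i, Nm p := by
  classical
  simp only [factorProd]
  rw [Finset.prod_comm]
  have h1 : ∀ i : Fin m, ∏ p ∈ T, (1 + c p i • ρ.tp p i) =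
      ∑ s ∈ T.powerset, (∏ p ∈ s, c p i) • ρ.t (Pi.mulSingle i (∏ p ∈ s, Nm p)) := by
    intro i
    rw [Finset.prod_one_add]
    refine Finset.sum_congr rfl fun s _ => ?_
    rw [Finset.prod_smul]
    congr 1
    simp only [tp]
    rw [← map_prod]
    congr 1
    exact (map_prod (MonoidHom.mulSingle (fun _ : Fin m => ℕ) i) _ _).symm
  simp_rw [h1]
  rw [Finset.prod_univ_sum]
  refine Finset.sum_congr rfl fun σ _ => ?_
  rw [Finset.prod_smul, ← map_prod]
  congr 2
  exact Finset.univ_prod_mulSingle fun i => ∏ p ∈ σ i, Nm p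

/-- A set of primes whose norm product is at most `X_i` lies in `T`, so the finite product already
sees every term; the sum over a box then factors into one-variable sums. -/
theorem act_prod_factorProd_delta (c : Pr K → Fin m → ℂ) (T : Finset (Pr K)) (X : Dom m)
    (hT : ∀ p, ∀ i, (Nm p : ℝ) ≤ X.coord i → p ∈ T) :
    ρ.act (∏ p ∈ T, ρ.factorProd c p) (delta m) X =
      ∏ i, (sumLe (fun s => ∏ p ∈ s, c p i) normProd (X.coord i) / X.coord i) := by
  classical
  have h1 : ∀ i, sumLe (fun s => ∏ p ∈ s, c p i) normProd (X.coord i) =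
      ∑ s ∈ T.powerset, if normProd s ≤ X.coord i then ∏ p ∈ s, c p i else 0 := by
    intro i
    rw [sumLe, tsum_eq_sum (s := T.powerset)]
    · exact Finset.sum_congr rfl fun s _ => by simp [Set.indicator]
    · intro s hs
      refine Set.indicator_of_notMem (show s ∉ {s | normProd s ≤ X.coord i} from
        fun (h : normProd s ≤ X.coord i) => hs ?_) _
      refine Finset.mem_powerset.2 fun p hp => hT p i (le_trans ?_ h)
      rw [normProd, ← Finset.mul_prod_erase s _ hp]
      exact le_mul_of_one_le_right (Nat.cast_nonneg _) (one_le_normProd (s.erase p))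
  rw [Finset.prod_div_distrib]
  simp_rw [h1]
  rw [Finset.prod_univ_sum, Finset.sum_div, prod_factorProd, map_sum]
  simp only [_root_.sum_apply, BoundedContinuousFunction.sum_apply]
  refine Finset.sum_congr rfl fun σ _ => ?_
  rw [map_smul]
  show (∏ i, ∏ p ∈ σ i, c p i) * ρ.act (ρ.t _) (delta m) X = _
  rw [act_t_delta _ _ fun i => Finset.prod_pos fun p _ => Nm_pos p]
  have h2 : ∀ i, ((∏ p ∈ σ i, Nm p : ℕ) : ℝ) = normProd (σ i) := fun i => by
    rw [normProd, Nat.cast_prod]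
  simp_rw [h2]
  rw [Finset.prod_ite_zero]
  simp only [Finset.mem_univ, true_implies]
  split_ifs
  · rw [div_eq_mul_inv]
  · simp

end ShiftRep

end
end MultiTauberian

/-! ### The formal expansion of the full Euler product. -/

namespace MultiTauberian
noncomputable section
open Set Topology BoundedContinuousFunction

variable {K : Type*} [Field K] [NumberField K] {m : ℕ}

theorem mem_of_selNorm_le {σ : Pr K →₀ Fin (m + 1)} {X : Fin m → ℝ} {T : Finset (Pr K)}
    (hT : ∀ p, ∀ i, (Nm p : ℝ) ≤ X i → p ∈ T) (hσ : ∀ i, (selNorm σ i : ℝ) ≤ X i) :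
    σ.support ⊆ T := by
  classical
  intro p hp
  obtain ⟨i, hi⟩ := Fin.exists_succ_eq.mpr (Finsupp.mem_support_iff.mp hp)
  have hdvd : Nm p ∣ selNorm σ i := Finset.dvd_prod_of_mem _ (by simp [hi.symm])
  have hpos : 0 < selNorm σ i := Finset.prod_pos fun q _ => Nm_pos q
  exact hT p i (le_trans (by exact_mod_cast Nat.le_of_dvd hpos hdvd) (hσ i))

theorem selCoeff_eq_prod {b : Pr K → ℂ} {c : Pr K → Fin m → ℂ} {T : Finset (Pr K)}
    (hb : ∀ p, b p ≠ 1 → p ∈ T) {σ : Pr K →₀ Fin (m + 1)} (hσ : σ.support ⊆ T) :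
    selCoeff b c σ = ∏ p ∈ T, (Fin.cons (b p) (c p) : Fin (m + 1) → ℂ) (σ p) := by
  refine finprod_eq_prod_of_mulSupport_subset _ fun p hp => ?_
  by_contra hpT
  have h1 : σ p = 0 := by
    by_contra h
    exact hpT (hσ (Finsupp.mem_support_iff.2 h))
  have h2 : b p = 1 := by
    by_contra h
    exact hpT (hb p h)
  exact hp (by simp [h1, h2])

-- Selections are regrouped by their monomial. A prime selected at `i` divides `selNorm σ i`, so the
-- bounds force the support into `T`.
open Classical in
theorem coeffSum_eq {b : Pr K → ℂ} {c : Pr K → Fin m → ℂ} {X : Fin m → ℝ} {T : Finset (Pr K)}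
    (hT : ∀ p, ∀ i, (Nm p : ℝ) ≤ X i → p ∈ T) (hX : ∀ i, 0 ≤ X i) :
    coeffSum b c X = ∑ σ ∈ T.finsupp fun _ => (Finset.univ : Finset (Fin (m + 1))),
      if ∀ i, (selNorm σ i : ℝ) ≤ X i then selCoeff b c σ else 0 := by
  rw [← Finset.sum_filter, ← Finset.sum_fiberwise_of_maps_to (g := fun σ => selNorm σ)
    (t := Fintype.piFinset fun i => Finset.Icc 1 ⌊X i⌋₊), coeffSum]
  · refine Finset.sum_congr rfl fun x hx => ?_
    rw [Fintype.mem_piFinset] at hx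
    rw [coeff, ← finsum_mem_coe_finset]
    refine finsum_mem_congr ?_ fun _ _ => rfl
    ext σ
    simp only [mem_ofPred_eq, Finset.coe_filter, Finset.mem_filter, Finset.mem_finsupp_iff,
      Finset.mem_univ, implies_true, and_true]
    constructor
    · intro h
      have hle : ∀ i, (selNorm σ i : ℝ) ≤ X i := fun i => by
        rw [h i]
        exact (Nat.le_floor_iff (hX i)).1 (Finset.mem_Icc.1 (hx i)).2
      exact ⟨⟨mem_of_selNorm_le hT hle, hle⟩, funext h⟩
    · rintro ⟨_, h⟩ i
      exact congrFun h i
  · intro σ hσ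
    rw [Finset.mem_filter] at hσ
    rw [Fintype.mem_piFinset]
    exact fun i => Finset.mem_Icc.2 ⟨Finset.prod_pos fun q _ => Nm_pos q, Nat.le_floor (hσ.2 i)⟩

namespace ShiftRep

variable {B : Type*} [NormedCommRing B] [NormedAlgebra ℂ B] (ρ : ShiftRep m B)

theorem prod_factor {b : Pr K → ℂ} {c : Pr K → Fin m → ℂ} {T : Finset (Pr K)}
    (hb : ∀ p, b p ≠ 1 → p ∈ T) :
    ∏ p ∈ T, ρ.factor b c p =
      ∑ σ ∈ T.finsupp fun _ => (Finset.univ : Finset (Fin (m + 1))),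
        selCoeff b c σ • ρ.t (selNorm σ) := by
  classical
  -- `y p j` is the monomial index of the summand `j` at `p`: trivial for `j = 0`, and `N(p)` in
  -- place `i` for `j = i.succ`.
  set y : Pr K → Fin (m + 1) → Fin m → ℕ := fun p j =>
    (Fin.cons 1 fun i => Pi.mulSingle i (Nm p) : Fin (m + 1) → Fin m → ℕ) j with hy
  have h1 : ∀ p, ρ.factor b c p = ∑ j : Fin (m + 1),
      (Fin.cons (b p) (c p) : Fin (m + 1) → ℂ) j • ρ.t (y p j) := by
    intro p
    rw [Fin.sum_univ_succ, factor]
    simp [hy, tp, Algebra.algebraMap_eq_smul_one]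
  simp_rw [h1]
  rw [Finset.prod_sum, Finset.finsupp, Finset.sum_map]
  refine Finset.sum_congr rfl fun f hf => ?_
  have hval : ∀ p (hp : p ∈ T), Finsupp.indicator T f p = f p hp := fun p hp =>
    Finsupp.indicator_of_mem hp f
  have hsupp : (Finsupp.indicator T f).support ⊆ T := Finsupp.support_indicator_subset _ _
  simp only [Function.Embedding.coeFn_mk]
  rw [selCoeff_eq_prod hb hsupp, Finset.prod_smul, ← Finset.prod_attach T, ← map_prod]
  congr 1
  · exact Finset.prod_congr rfl fun p _ => by rw [hval p.1 p.2]
  · congr 1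
    funext i
    have hy1 : ∀ p j, y p j i = if j = i.succ then Nm p else 1 := by
      intro p j
      refine Fin.cases ?_ (fun k => ?_) j
      · simp [hy, (Fin.succ_ne_zero i).symm]
      · simp only [hy, Fin.cons_succ, Fin.succ_inj, Pi.mulSingle_apply, eq_comm]
    have hfilter : {p ∈ (Finsupp.indicator T f).support | Finsupp.indicator T f p = i.succ} =
        {p ∈ T | Finsupp.indicator T f p = i.succ} := by
      ext p
      simp only [Finset.mem_filter, and_congr_left_iff]
      intro hp
      refine ⟨fun h => hsupp h, fun _ => Finsupp.mem_support_iff.2 ?_⟩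
      rw [hp]
      exact Fin.succ_ne_zero i
    rw [selNorm, hfilter, Finset.prod_filter, Finset.prod_apply, ← Finset.prod_attach T]
    refine Finset.prod_congr rfl fun p _ => ?_
    rw [hy1, hval p.1 p.2]

theorem act_prod_factor_delta {b : Pr K → ℂ} {c : Pr K → Fin m → ℂ} {T : Finset (Pr K)}
    (hb : ∀ p, b p ≠ 1 → p ∈ T) {X : Dom m} (hT : ∀ p, ∀ i, (Nm p : ℝ) ≤ X.coord i → p ∈ T)
    (hX : ∀ i, 0 ≤ X.coord i) :
    ρ.act (∏ p ∈ T, ρ.factor b c p) (delta m) X =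
      coeffSum b c X.coord / ∏ i, (X.coord i : ℂ) := by
  classical
  rw [prod_factor ρ hb, coeffSum_eq hT hX, map_sum, Finset.sum_div]
  simp only [_root_.sum_apply, BoundedContinuousFunction.sum_apply]
  refine Finset.sum_congr rfl fun σ _ => ?_
  rw [map_smul]
  show selCoeff b c σ * ρ.act (ρ.t (selNorm σ)) (delta m) X = _
  rw [act_t_delta ρ (selNorm σ) fun i => Finset.prod_pos fun p _ => Nm_pos p]
  split_ifs
  · rw [div_eq_mul_inv]
  · simp

end ShiftRep

end
end MultiTauberian

/-! ### Transfer of the asymptotics to several variables. -/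

namespace MultiTauberian
noncomputable section
open Set Topology BoundedContinuousFunction

variable {K : Type*} [Field K] [NumberField K] {m : ℕ}

theorem tendsto_apply_atTop (i : Fin m) : Tendsto (fun X : Fin m → ℝ => X i) atTop atTop := by
  refine tendsto_atTop.2 fun A => ?_
  filter_upwards [eventually_ge_atTop fun _ => A] with X hX using hX i

/-- A bounded product of normalized summatory functions, as a bounded function. -/
theorem exists_bounded_prod {S : Fin m → ℝ → ℂ} {r : Fin m → ℂ}
    (hS : ∀ i, Tendsto (fun x => S i x / x) atTop (𝓝 (r i)))
    (hM : ∀ i, ∃ M, ∀ x, ‖S i x‖ ≤ M * |x|) :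
    ∃ Ψ : Dom m →ᵇ ℂ, (∀ X : Dom m, Ψ X = ∏ i, (S i (X.coord i) / X.coord i)) ∧
      Tendsto (fun X : Fin m → ℝ => Ψ ⟨X⟩) atTop (𝓝 (∏ i, r i)) := by
  choose M hM using hM
  refine ⟨BoundedContinuousFunction.ofNormedAddCommGroupDiscrete
    (fun X : Dom m => ∏ i, (S i (X.coord i) / X.coord i)) (∏ i, |M i|) fun X => ?_, fun X => rfl, ?_⟩
  · rw [norm_prod]
    refine Finset.prod_le_prod (fun _ _ => norm_nonneg _) fun i _ => ?_
    rw [norm_div, Complex.norm_real, Real.norm_eq_abs]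
    refine div_le_of_le_mul₀ (abs_nonneg _) (abs_nonneg _) ((hM i _).trans ?_)
    exact mul_le_mul_of_nonneg_right (le_abs_self _) (abs_nonneg _)
  · exact tendsto_finsetProd _ fun i _ => (hS i).comp (tendsto_apply_atTop i)

namespace ShiftRep

variable {B : Type*} [NormedCommRing B] [NormedAlgebra ℂ B] (ρ : ShiftRep m B)

/-- For finite `T` containing all primes of norm at most `∑ X_i`, `Ψ` agrees on that box with `∏_{p
∈ T} factorProd` applied to `delta`. By causality `∏_{p ∈ T} h p` cannot tell the two apart at `X`,
and `h p * factorProd = factor` gives the coefficient sum. The value is thus eventually constant in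
`T`, while the products tend to `H`. -/
theorem act_eq_coeffSum_div {b : Pr K → ℂ} {c ct : Pr K → Fin m → ℂ} (hb : {p | b p ≠ 1}.Finite)
    {h : Pr K → B} (hh : ∀ p, h p * ρ.factorProd ct p = ρ.factor b c p) {H : B} (hH : HasProd h H)
    {Ψ : Dom m →ᵇ ℂ} (hΨ : ∀ X : Dom m, Ψ X =
      ∏ i, (sumLe (fun s => ∏ p ∈ s, ct p i) normProd (X.coord i) / X.coord i))
    (X : Fin m → ℝ) (hX : ∀ i, 0 ≤ X i) :
    ρ.act H Ψ ⟨X⟩ = coeffSum b c X / ∏ i, (X i : ℂ) := by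
  classical
  have hcont : Continuous fun a : B => ρ.act a Ψ ⟨X⟩ :=
    (BoundedContinuousFunction.lipschitz_eval_const (Dom.mk X)).continuous.comp
      ((ContinuousLinearMap.apply ℂ _ Ψ).continuous.comp ρ.continuous_act)
  have hlim : Tendsto (fun T : Finset (Pr K) => ρ.act (∏ p ∈ T, h p) Ψ ⟨X⟩) atTop
      (𝓝 (ρ.act H Ψ ⟨X⟩)) := (hcont.tendsto H).comp hH
  have hZ0 : 0 ≤ ∑ i, X i := Finset.sum_nonneg fun i _ => hX i
  have hXZ : ∀ i, X i ≤ ∑ i, X i := fun i =>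
    Finset.single_le_sum (f := X) (fun j _ => hX j) (Finset.mem_univ i)
  refine tendsto_nhds_unique hlim (tendsto_const_nhds.congr' ?_)
  filter_upwards [eventually_ge_atTop ((finite_Nm_le (K := K) (∑ i, X i)).toFinset ∪ hb.toFinset)]
    with T hT
  have hT1 : ∀ p, (Nm p : ℝ) ≤ ∑ i, X i → p ∈ T := fun p hp =>
    hT (Finset.mem_union_left _ ((Set.Finite.mem_toFinset _).2 hp))
  have hT2 : ∀ p, b p ≠ 1 → p ∈ T := fun p hp =>
    hT (Finset.mem_union_right _ ((Set.Finite.mem_toFinset _).2 hp))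
  have h0 := ρ.act_eq_zero (∏ p ∈ T, h p) _ hZ0
    (Ψ - ρ.act (∏ p ∈ T, ρ.factorProd ct p) (delta m)) (fun Y hY => by
      rw [BoundedContinuousFunction.sub_apply, hΨ, ρ.act_prod_factorProd_delta ct T Y fun p i hp =>
        hT1 p (hp.trans (hY i)), sub_self]) ⟨X⟩ hXZ
  rw [map_sub, BoundedContinuousFunction.sub_apply, sub_eq_zero] at h0
  rw [h0, ← ρ.act_prod_factor_delta hT2 (X := ⟨X⟩) (fun p i hp => hT1 p (hp.trans (hXZ i))) hX,
    ← Finset.prod_congr rfl fun p _ => hh p, Finset.prod_mul_distrib, map_mul]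
  rfl

end ShiftRep

theorem summable_of_le_Nm_sq {B : Type*} [NormedCommRing B] [CompleteSpace B] {x : Pr K → B}
    {A : ℝ} (hA : ∀ p, ‖x p‖ ≤ A * ((Nm p : ℝ) ^ 2)⁻¹) : Summable fun p => ‖x p‖ := by
  refine ((summable_Nm_rpow one_lt_two).mul_left A).of_nonneg_of_le (fun _ => norm_nonneg _)
    fun p => (hA p).trans_eq ?_
  rw [Real.rpow_neg (Nat.cast_nonneg _), Real.rpow_two]

theorem tendsto_coeffSum_div {b : Pr K → ℂ} {c : Pr K → Fin m → ℂ} (hb : {p | b p ≠ 1}.Finite)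
    {C E₁ : ℝ} (hc : ∀ p i, ‖c p i‖ ≤ C) (hC : 0 ≤ C) (hE₁ : 2 * C ≤ E₁)
    (hb1 : ∀ p, E₁ < (Nm p : ℝ) → b p = 1) {r : Fin m → ℂ}
    (hS : ∀ i, Tendsto (fun x =>
      sumLe (fun s => ∏ p ∈ s, cutoff E₁ (fun q => c q i) p) normProd x / x) atTop (𝓝 (r i)))
    (hM : ∀ i, ∃ M, ∀ x,
      ‖sumLe (fun s => ∏ p ∈ s, cutoff E₁ (fun q => c q i) p) normProd x‖ ≤ M * |x|)
    (hne : ∀ p, E₁ < (Nm p : ℝ) → ∀ i, localFactorOne (fun q => c q i) p 1 ≠ 0) :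
    ∃ Q : ℂ, HasProd ({p : Pr K | E₁ < (Nm p : ℝ)}.mulIndicator (localQuotient b c)) Q ∧
      Tendsto (fun X : Fin m → ℝ => coeffSum b c X / ∏ i, (X i : ℂ)) atTop
        (𝓝 ((∏ p ∈ (finite_Nm_le (K := K) E₁).toFinset, localFactor b c p fun _ => 1) * Q *
          ∏ i, r i)) := by
  classical
  obtain ⟨B, _, _, _, _, ⟨ρ⟩⟩ := exists_shiftRep m
  set ct : Pr K → Fin m → ℂ := fun p i => cutoff E₁ (fun q => c q i) p with hct
  have hct1 : ∀ p, E₁ < (Nm p : ℝ) → ct p = c p := fun p hp => by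
    funext i
    exact Set.indicator_of_mem (show p ∈ {p : Pr K | E₁ < (Nm p : ℝ)} from hp) _
  have hct0 : ∀ p, ¬ E₁ < (Nm p : ℝ) → ct p = 0 := fun p hp => by
    funext i
    exact Set.indicator_of_notMem (show p ∉ {p : Pr K | E₁ < (Nm p : ℝ)} from hp) _
  -- Invertibility holds at every prime: above `E₁ ≥ 2 C` by size, and below because the cut-off
  -- coefficients vanish, in which case `h p` is `D_p` itself.
  have hcth : ∀ p i, ‖ct p i‖ ≤ Nm p / 2 := fun p i => by
    by_cases hp : E₁ < (Nm p : ℝ)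
    · rw [hct1 p hp]
      linarith [hc p i]
    · rw [hct0 p hp, Pi.zero_apply, norm_zero]
      positivity
  choose h hh hh1 using fun p => ρ.exists_quotient b c ct p (hcth p)
  obtain ⟨Ψ, hΨ, hΨlim⟩ := exists_bounded_prod hS hM
  set U : Set (Pr K) := {p | E₁ < (Nm p : ℝ)} with hU
  set F := (finite_Nm_le (K := K) E₁).toFinset with hF
  have hFU : ∀ p, p ∈ F ↔ p ∉ U := fun p => by simp [hF, hU]
  have hmult : Multipliable (U.mulIndicator h) := by
    have h1 := multipliable_one_add_of_summable (f := U.indicator fun p => h p - 1)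
      (summable_of_le_Nm_sq (A := 2 ^ m * (4 ^ m * C ^ 2)) fun p => ?_)
    · refine h1.congr fun p => ?_
      by_cases hp : p ∈ U <;> simp [hp]
    · by_cases hp : p ∈ U
      · rw [Set.indicator_of_mem hp]
        refine (hh1 p (hb1 p hp) (hct1 p hp).symm C (hc p) ?_).trans_eq ?_
        · have : E₁ < (Nm p : ℝ) := hp
          linarith
        · rw [div_pow]
          ring
      · rw [Set.indicator_of_notMem hp, norm_zero]
        positivity
  obtain ⟨HU, hHU⟩ := hmult
  have hHF : HasProd (fun p => if p ∈ F then h p else 1) (∏ p ∈ F, h p) := by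
    have := hasProd_prod_of_ne_finset_one (s := F) (f := fun p => if p ∈ F then h p else 1)
      (L := SummationFilter.unconditional _) fun p hp => if_neg hp
    rwa [Finset.prod_congr rfl fun p hp => if_pos hp] at this
  have hH : HasProd h ((∏ p ∈ F, h p) * HU) := by
    convert! hHF.mul hHU using 1
    funext p
    by_cases hp : p ∈ U
    · simp [hFU, hp]
    · simp [hFU, hp]
  have hchi : ∀ p, ρ.chi (h p) * ∏ i, localFactorOne (fun q => ct q i) p 1 =
      localFactor b c p fun _ => 1 := fun p => by
    rw [← ρ.chi_factorProd, ← map_mul, hh p, ShiftRep.chi_factor]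
  have hchiU : ∀ p ∈ U, ρ.chi (h p) = localQuotient b c p := fun p hp => by
    rw [localQuotient, eq_div_iff (Finset.prod_ne_zero_iff.2 fun i _ => hne p hp i), ← hchi p]
    simp only [localFactorOne, hct1 p hp]
  have hchiF : ∀ p ∈ F, ρ.chi (h p) = localFactor b c p fun _ => 1 := fun p hp => by
    rw [← hchi p]
    simp [localFactorOne, hct0 p ((hFU p).1 hp)]
  refine ⟨ρ.chi HU, ?_, ?_⟩
  · have := hHU.map ρ.chi ρ.continuous_chi
    convert! this using 1
    funext p
    by_cases hp : p ∈ U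
    · simp [hp, hchiU p hp]
    · simp [hp]
  · have h1 := ρ.tendsto_act ((∏ p ∈ F, h p) * HU) Ψ _ hΨlim
    have h2 : ρ.chi ((∏ p ∈ F, h p) * HU) =
        (∏ p ∈ F, localFactor b c p fun _ => 1) * ρ.chi HU := by
      rw [map_mul, map_prod, Finset.prod_congr rfl hchiF]
    rw [h2] at h1
    refine h1.congr' ?_
    filter_upwards [eventually_ge_atTop fun _ => (0 : ℝ)] with X hX
    exact ρ.act_eq_coeffSum_div hb hh hH hΨ X hX

end
end MultiTauberian

/-! ### Change of threshold and conclusion. -/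

namespace MultiTauberian

noncomputable section

open Set Topology

variable {K : Type*} [Field K] [NumberField K] {m : ℕ}

/-- The majorant keeps the threshold `E₀`: its factors may vanish on `Re s = 1`, so those with norm
in `(E₀, E₁]` cannot be divided out. Being nonnegative, its coefficients still dominate the ones cut
off at `E₁`. -/
theorem tendsto_sumLe_cutoff {E₀ E₁ : ℝ} (hE : E₀ ≤ E₁) {γ : Pr K → ℂ} {γ' : Pr K → ℝ} {B : ℝ}
    (hB : ∀ p, γ' p ≤ B) (hγ : ∀ p, ‖γ p‖ ≤ γ' p)
    (hne : ∀ p, E₀ < (Nm p : ℝ) → ∀ s : ℂ, s.re = 1 → localFactorOne γ p s ≠ 0) {r r' : ℂ}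
    (h : ContinuesWithValue (fun s => (s - 1) * tailProduct E₀ γ s) r)
    (h' : ContinuesWithValue (fun s => (s - 1) * tailProduct E₀ (fun p => (γ' p : ℂ)) s) r') :
    Tendsto (fun x => sumLe (fun t => ∏ p ∈ t, cutoff E₁ γ p) normProd x / x) atTop
        (𝓝 (r / ∏ p ∈ primesBetween E₀ E₁, localFactorOne γ p 1)) ∧
      ∃ M, ∀ x, ‖sumLe (fun t => ∏ p ∈ t, cutoff E₁ γ p) normProd x‖ ≤ M * |x| := by
  have h0 : ∀ p, 0 ≤ γ' p := fun p => (norm_nonneg _).trans (hγ p)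
  have h1 := continuesToLine_of_tailProduct hE (fun p => (hγ p).trans (hB p))
    (fun p hp => hne p (mem_primesBetween.1 hp).1) h
  have h2 := continuesToLine_of_tailProduct le_rfl (γ := fun p => (γ' p : ℂ)) (B := B)
    (fun p => by rw [Complex.norm_real, Real.norm_of_nonneg (h0 p)]; exact hB p)
    (fun p hp => absurd (mem_primesBetween.1 hp).1 (not_lt.2 (mem_primesBetween.1 hp).2)) h'
  have h3 : cutoff E₀ (fun p => (γ' p : ℂ)) = fun p : Pr K =>
      (({p : Pr K | E₀ < (Nm p : ℝ)}.indicator γ' p : ℝ) : ℂ) := by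
    funext p
    by_cases hp : E₀ < (Nm p : ℝ) <;> simp [cutoff, indicator, hp]
  rw [h3] at h2
  refine tendsto_sumLe_prod (fun p => (indicator_le_self' (fun _ _ => h0 _) p).trans (hB p))
    (fun p => ?_) h1 h2
  by_cases hp : E₁ < (Nm p : ℝ)
  · simpa [cutoff, indicator, hp, hE.trans_lt hp] using hγ p
  · simpa [cutoff, indicator, hp] using ite_nonneg (h0 p) le_rfl

theorem hasProd_mulIndicator_of_le {E₀ E₁ : ℝ} (hE : E₀ ≤ E₁) {f : Pr K → ℂ} {Q : ℂ}
    (hQ : HasProd ({p : Pr K | E₁ < (Nm p : ℝ)}.mulIndicator f) Q) :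
    HasProd ({p : Pr K | E₀ < (Nm p : ℝ)}.mulIndicator f)
      ((∏ p ∈ primesBetween E₀ E₁, f p) * Q) := by
  classical
  have h1 : HasProd (fun p => if p ∈ primesBetween E₀ E₁ then f p else 1)
      (∏ p ∈ primesBetween E₀ E₁, f p) := by
    have := hasProd_prod_of_ne_finset_one (s := primesBetween E₀ E₁)
      (f := fun p => if p ∈ primesBetween E₀ E₁ then f p else 1)
      (L := SummationFilter.unconditional _) fun p hp => if_neg hp
    rwa [Finset.prod_congr rfl fun p hp => if_pos hp] at this
  convert! h1.mul hQ using 1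
  funext p
  by_cases hp1 : E₁ < (Nm p : ℝ)
  · simp [mem_primesBetween, mulIndicator, hp1, hE.trans_lt hp1]
  · by_cases hp0 : E₀ < (Nm p : ℝ)
    · simp [mem_primesBetween, mulIndicator, hp0, hp1, not_lt.1 hp1]
    · simp [mem_primesBetween, mulIndicator, hp0, hp1]

theorem prod_Nm_le_eq_mul {E₀ E₁ : ℝ} (hE : E₀ ≤ E₁) (f : Pr K → ℂ) :
    ∏ p ∈ (finite_Nm_le (K := K) E₁).toFinset, f p =
      (∏ᶠ p ∈ {p : Pr K | (Nm p : ℝ) ≤ E₀}, f p) * ∏ p ∈ primesBetween E₀ E₁, f p := by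
  classical
  rw [finprod_mem_eq_finite_toFinset_prod _ (finite_Nm_le E₀), ← Finset.prod_union]
  · congr 1
    ext p
    simp only [Set.Finite.mem_toFinset, Set.mem_ofPred_eq, Finset.mem_union, mem_primesBetween]
    constructor
    · intro h
      rcases le_or_gt (Nm p : ℝ) E₀ with h0 | h0
      · exact Or.inl h0
      · exact Or.inr ⟨h0, h⟩
    · rintro (h | h)
      · exact h.trans hE
      · exact h.2
  · refine Finset.disjoint_left.2 fun p h1 h2 => ?_
    rw [Set.Finite.mem_toFinset] at h1
    exact absurd (mem_primesBetween.1 h2).1 (not_lt.2 h1)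

theorem isLittleO_sub_mul_prod {f : (Fin m → ℝ) → ℂ} {C : ℂ}
    (h : Tendsto (fun X : Fin m → ℝ => f X / ∏ i, (X i : ℂ)) atTop (𝓝 C)) :
    (fun X => f X - C * ∏ i, (X i : ℂ)) =o[atTop] fun X : Fin m → ℝ => ∏ i, X i := by
  have h1 : (fun X : Fin m → ℝ => f X / ∏ i, (X i : ℂ) - C) =o[atTop] fun _ => (1 : ℝ) :=
    (isLittleO_one_iff ℝ).2 (by simpa using h.sub_const C)
  have h2 : (fun X : Fin m → ℝ => ∏ i, (X i : ℂ)) =O[atTop] fun X : Fin m → ℝ => ∏ i, X i :=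
    isBigO_of_le _ fun X => by rw [norm_prod, norm_prod]; simp
  have h3 := h1.mul_isBigO h2
  simp only [one_mul] at h3
  refine h3.congr' ?_ EventuallyEq.rfl
  filter_upwards [eventually_ge_atTop fun _ => (1 : ℝ)] with X hX
  have hne : ∏ i, (X i : ℂ) ≠ 0 := Finset.prod_ne_zero_iff.2 fun i _ => by
    exact_mod_cast (zero_lt_one.trans_le (hX i)).ne'
  rw [sub_mul, div_mul_cancel₀ _ hne]

end
end MultiTauberian

theorem mainTheorem2 {K : Type*} [Field K] [NumberField K] (m : ℕ)
    (b : MultiTauberian.Pr K → ℂ) (c : MultiTauberian.Pr K → Fin m → ℂ)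
    (hb : {p | b p ≠ 1}.Finite)
    (hc : ∃ B : ℝ, ∀ p i, ‖c p i‖ ≤ B)
    (E₀ : ℝ)
    (hE₀b : ∀ p, E₀ < (MultiTauberian.Nm p : ℝ) → b p = 1)
    (hE₀D : ∀ p, E₀ < (MultiTauberian.Nm p : ℝ) → ∀ i, ∀ s : ℂ, s.re = 1 →
      MultiTauberian.localFactorOne (fun q => c q i) p s ≠ 0)
    (r : Fin m → ℂ)
    (hcont : ∀ i, MultiTauberian.ContinuesWithValue
      (fun s => (s - 1) * MultiTauberian.tailProduct E₀ (fun p => c p i) s) (r i))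
    (c' : MultiTauberian.Pr K → Fin m → ℝ)
    (hc' : ∃ B : ℝ, ∀ p i, c' p i ≤ B)
    (hcc' : ∀ p i, ‖c p i‖ ≤ c' p i)
    (hcont' : ∀ i, ∃ r' : ℂ, MultiTauberian.ContinuesWithValue
      (fun s => (s - 1) * MultiTauberian.tailProduct E₀ (fun p => (c' p i : ℂ)) s) r') :
    Multipliable (fun p : {p : MultiTauberian.Pr K // E₀ < (MultiTauberian.Nm p : ℝ)} =>
      MultiTauberian.localQuotient b c p.1) ∧
    (fun X : Fin m → ℝ =>
      MultiTauberian.coeffSum b c X - MultiTauberian.mainConst b c E₀ r * ∏ i, (X i : ℂ))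
      =o[atTop] (fun X : Fin m → ℝ => ∏ i, X i) := by
  obtain ⟨B, hB⟩ := hc
  obtain ⟨B', hB'⟩ := hc'
  choose r' hr' using hcont'
  have hE : E₀ ≤ max E₀ (2 * max B 0) := le_max_left _ _
  -- Above this threshold `‖c p i‖ / N(p)` is less than `1 / 2`, as the geometric series requires.
  set E₁ := max E₀ (2 * max B 0) with hE₁
  have hS := fun i => MultiTauberian.tendsto_sumLe_cutoff hE (hB' · i) (hcc' · i)
    (fun p hp => hE₀D p hp i) (hcont i) (hr' i)
  obtain ⟨Q, hQ, hlim⟩ := MultiTauberian.tendsto_coeffSum_div hb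
    (fun p i => (hB p i).trans (le_max_left B 0)) (le_max_right B 0) (le_max_right _ _)
    (fun p hp => hE₀b p (hE.trans_lt hp)) (fun i => (hS i).1) (fun i => (hS i).2)
    (fun p hp i => hE₀D p (hE.trans_lt hp) i 1 Complex.one_re)
  have hQ₀ := hasProd_subtype_iff_mulIndicator.2 (MultiTauberian.hasProd_mulIndicator_of_le hE hQ)
  refine ⟨hQ₀.multipliable, MultiTauberian.isLittleO_sub_mul_prod ?_⟩
  have htp : ∏' p : {p : MultiTauberian.Pr K // E₀ < (MultiTauberian.Nm p : ℝ)},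
      MultiTauberian.localQuotient b c p.1 = _ := hQ₀.tprod_eq
  convert! hlim using 2
  -- For primes with norm in `(E₀, E₁]`, the divisors of `r i` and the factors `D_p(1, …, 1)`
  -- recombine into local quotients, so `E₁` disappears.
  rw [MultiTauberian.mainConst, htp, MultiTauberian.prod_Nm_le_eq_mul hE]
  simp only [MultiTauberian.localQuotient, Finset.prod_div_distrib]
  rw [Finset.prod_comm]
  ring
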